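/- **Setting.** A $\Sigma$-protocol $\Sigma$ consists of a generator $\mathsf{Gen}$ of pairs (instance, witness), a function $\mu$ with $\mu(w)=\mathsf{inst}$ for all generated pairs, prover algorithms $P_1(\mathsf{inst})\to(\mathsf{com},\mathsf{st})$ and $P_2(\mathsf{st},w,\mathsf{ch})\to\mathsf{rsp}$, a verifier that sends a uniformly random challenge $\mathsf{ch}$ from a set $\mathcal C$, and a deterministic predicate $V_2(\mathsf{inst},\mathsf{com},\mathsf{ch},\mathsf{rsp})$. The sets of instances, commitments, challenges and messages are finite, the sets of commitments and responses are non-empty, and $\mathcal C$ carries an abelian group structure (for bit strings: $\oplus$). A ring is a list $\rho=(\mathsf{inst}_1,\dots,\mathsf{inst}_n)$ of $1\le n\le\kappa$ distinct instances. In the ring signature scheme $\mathsf{AOS}(\Sigma)$ (built from $\Sigma$ and a simulator; the keys are the pairs output by $\mathsf{Gen}$) a signature on a message $m$ is $\sigma=((\mathsf{com}_1,\mathsf{rsp}_1),\dots,(\mathsf{com}_n,\mathsf{rsp}_n))$. It is valid iff $V_2(\mathsf{inst}_j,\mathsf{com}_j,\mathsf{ch}_j,\mathsf{rsp}_j)$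 holds for all $j$, where $\mathsf{ch}_j=H(j,\rho,\mathsf{com}_{j-1},m)$ with $\mathsf{com}_0:=\mathsf{com}_n$. For $N\le\kappa$, $\mathsf{Adv}^{\mathsf{UF\text{-}NRA}}_{\mathcal A,\mathsf{AOS}(\Sigma),N}$ is the probability that $\mathcal A$, given $N$ independently generated instances and quantum access $|x\rangle|y\rangle\mapsto|x\rangle|y+H(x)\rangle$ to a uniformly random function $H$ with values in $\mathcal C$ (and no signing oracle), outputs a ring all of whose members are among the given instances, a message, and a valid signature. Here $\mathcal A$ is a quantum algorithm: a sequence of unitaries (depending on the given instances) interleaved with the queries, followed by a measurement. $\mathsf{Adv}^{\mathsf{IMP}}_{\mathcal B,\Sigma}$ is the probability that a two-stage quantum adversary $\mathcal B$, given only a generated instance $\mathsf{inst}$, first outputs $\mathsf{com}$, then receives a uniformly random $\mathsf{ch}\in\mathcal C$, and outputs $\mathsf{rsp}$ such that $V_2(\mathsf{inst},\mathsf{com},\mathsf{ch},\mathsf{rsp})$ holds. **Theorem.** Let $N\le\kappa$. For every $\Sigma$-protocol $\Sigma$, every simulator, and every $\mathsf{UF\text{-}NRA}$ adversary $\mathcal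 A$ making at most $q_H$ quantum queries to $H$, there is an impersonation adversary $\mathcal B$ such that $$\mathsf{Adv}^{\mathsf{UF\text{-}NRA}}_{\mathcal A,\mathsf{AOS}(\Sigma),N}\;\le\;\tfrac12\,\bigl(2(q_H+N)+1\bigr)^{2N}\cdot\mathsf{Adv}^{\mathsf{IMP}}_{\mathcal B,\Sigma}.$$ Moreover $\mathcal B$ is obtained from $\mathcal A$ by a black-box reduction without rewinding. The reduction is fixed once the parameters $\kappa$, $N$, $q_H$, the number of queries of $\mathcal A$ and the underlying sets are fixed, and does not depend on $\Sigma$ or $\mathcal A$. It draws at most $N$ further instances from $\mathsf{Gen}$, goes through the unitaries of $\mathcal A$ in order once before sending $\mathsf{com}$ and once after receiving $\mathsf{ch}$ (applying each of them under the control of its own memory), and apart from reading $\mathcal A$'s output acts only on $\mathcal A$'s query and answer registers and on its own memory. -/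

import Mathlib

/-! ## Sigma protocols -/

/-- A three-move public-coin identification protocol.  The verifier's first algorithm draws a
uniformly random challenge from `Chal`, independently of everything else; its second algorithm is
the deterministic predicate `verify`.  `mu` recovers the instance from a witness. -/
structure SigmaProtocol (Inst Wit St Com Chal Rsp : Type) where
  gen : PMF (Inst × Wit)
  mu : Wit → Inst
  mu_gen : ∀ p ∈ gen.support, mu p.2 = p.1
  prove₁ : Inst → PMF (Com × St)
  prove₂ : St → Wit → Chal → PMF Rsp
  verify : Inst → Com → Chal → Rsp → Bool

/-- The distribution of the public instance produced by the generator. -/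
noncomputable def SigmaProtocol.instDist {Inst Wit St Com Chal Rsp : Type}
    (S : SigmaProtocol Inst Wit St Com Chal Rsp) : PMF Inst :=
  S.gen.map Prod.fst

/-- `n` independent samples of a distribution on a finite type. -/
noncomputable def iidPMF {α : Type} (p : PMF α) : (n : ℕ) → PMF (Fin n → α)
  | 0 => PMF.pure Fin.elim0
  | n + 1 => p.bind fun a => (iidPMF p n).map fun v => Fin.cons a v

/-! ## Rings and ring signatures with a random oracle `X → C` -/

/-- A ring of at least one and at most `κ` distinct public keys, listed in some order.
The first component `n` stands for a ring with `n + 1` members. -/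
abbrev KeyRing (κ : ℕ) (PK : Type) : Type := Σ n : Fin κ, (Fin (n.val + 1) ↪ PK)

/-- A ring signature scheme whose algorithms use a hash function `X → C`.
Signing returns `none` if the secret key belongs to no member of the ring. -/
structure RingSignature (κ : ℕ) (PK SK Msg : Type) (Sig : KeyRing κ PK → Type) (X C : Type) where
  keyGen : PMF (PK × SK)
  sign : (X → C) → SK → (ρ : KeyRing κ PK) → Msg → PMF (Option (Sig ρ))
  verify : (X → C) → (ρ : KeyRing κ PK) → Msg → Sig ρ → Bool

/-- What a forger outputs: a ring, a message and a signature. -/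
abbrev Forgery {κ : ℕ} {PK : Type} (Msg : Type) (Sig : KeyRing κ PK → Type) : Type :=
  Σ ρ : KeyRing κ PK, Msg × Sig ρ

/-! ## The ring signature `AOS(Σ)` -/

/-- Inputs `(j, ρ, com, m)` of the hash function. -/
abbrev HashInput (κ : ℕ) (Inst Com Msg : Type) : Type := Fin κ × KeyRing κ Inst × Com × Msg

/-- A signature consists of one commitment and one response for every ring member. -/
abbrev AOSSig (Com Rsp : Type) {κ : ℕ} {Inst : Type} (ρ : KeyRing κ Inst) : Type :=
  Fin (ρ.1.val + 1) → Com × Rsp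

/-- The challenge `H(j, ρ, com, m)` of ring position `j`.  Positions are counted from `0`
and computed modulo the ring size. -/
def aosChallenge {κ : ℕ} {Inst Com Msg Chal : Type} (H : HashInput κ Inst Com Msg → Chal)
    (ρ : KeyRing κ Inst) (m : Msg) (j : Fin (ρ.1.val + 1)) (com : Com) : Chal :=
  H (⟨j.val, lt_of_lt_of_le j.isLt ρ.1.isLt⟩, ρ, com, m)

/-- The simulated part of a signature: starting at position `j`, whose predecessor has the
commitment `com`, simulate the transcripts of `t` consecutive ring members. -/
noncomputable def aosChain {κ : ℕ} {Inst Com Msg Chal Rsp : Type}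
    (Sim : Inst → Chal → PMF (Com × Rsp)) (H : HashInput κ Inst Com Msg → Chal)
    (ρ : KeyRing κ Inst) (m : Msg) :
    (t : ℕ) → Fin (ρ.1.val + 1) → Com → PMF (Fin t → Com × Rsp)
  | 0, _, _ => PMF.pure Fin.elim0
  | t + 1, j, com =>
      (Sim (ρ.2 j) (aosChallenge H ρ m j com)).bind fun cr =>
        (aosChain Sim H ρ m t (j + 1) cr.1).map fun rest => Fin.cons cr rest

/-- Signing for the member at position `i` with witness `w`.  The transcript of position `i + k`
is the `k`-th entry of the chain, and `k = 0` is the real prover's transcript. -/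
noncomputable def aosSignAt {κ : ℕ} {Inst Wit St Com Msg Chal Rsp : Type}
    (S : SigmaProtocol Inst Wit St Com Chal Rsp) (Sim : Inst → Chal → PMF (Com × Rsp))
    (H : HashInput κ Inst Com Msg → Chal) (w : Wit) (ρ : KeyRing κ Inst) (m : Msg)
    (i : Fin (ρ.1.val + 1)) : PMF (AOSSig Com Rsp ρ) :=
  (S.prove₁ (ρ.2 i)).bind fun cs =>
    (aosChain Sim H ρ m ρ.1.val (i + 1) cs.1).bind fun chain =>
      let coms : Fin (ρ.1.val + 1) → Com := Fin.cons cs.1 fun k => (chain k).1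
      (S.prove₂ cs.2 w (aosChallenge H ρ m i (coms (Fin.last _)))).map fun rsp =>
        let τ : Fin (ρ.1.val + 1) → Com × Rsp := Fin.cons (cs.1, rsp) chain
        fun j => τ (j - i)

open Classical in
/-- The ring signature obtained from a Sigma protocol and a simulator for it by letting the
challenge of each ring member be the hash of the commitment of its cyclic predecessor. -/
noncomputable def AOS (κ : ℕ) {Inst Wit St Com Chal Rsp : Type} (Msg : Type)
    (S : SigmaProtocol Inst Wit St Com Chal Rsp) (Sim : Inst → Chal → PMF (Com × Rsp)) :
    RingSignature κ Inst Wit Msg (AOSSig Com Rsp) (HashInput κ Inst Com Msg) Chal where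
  keyGen := S.gen
  sign H w ρ m :=
    if h : ∃ i, S.mu w = ρ.2 i then (aosSignAt S Sim H w ρ m h.choose).map some
    else PMF.pure none
  verify H ρ m σ :=
    decide (∀ j, S.verify (ρ.2 j) (σ j).1 (aosChallenge H ρ m j (σ (j - 1)).1) (σ j).2 = true)

/-! ## Quantum adversaries against unforgeability under no-ring attacks -/

/-- A quantum algorithm that receives `N` public keys, makes `q` quantum queries to an oracle
`X → C` and outputs a forgery.  Its registers are the query register `X`, the answer register `C`
and a work register `Work`.  It applies `step pk 0`, query, `step pk 1`, query, …, query,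
`step pk q` to a basis state, then measures all registers and outputs a function `out` of the
result (the values of `step` beyond `q` are not used). -/
structure NRAAdversary {κ : ℕ} (N q : ℕ) {PK : Type} (Msg : Type) (Sig : KeyRing κ PK → Type)
    (X C : Type) [Fintype X] [DecidableEq X] [Fintype C] [DecidableEq C] where
  Work : Type
  [fintypeWork : Fintype Work]
  [decEqWork : DecidableEq Work]
  start : (X × C) × Work
  step : (Fin N → PK) → ℕ → Matrix.unitaryGroup ((X × C) × Work) ℂ
  out : (X × C) × Work → Forgery Msg Sig

attribute [instance] NRAAdversary.fintypeWork NRAAdversary.decEqWork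

/-- The query `|x⟩|c⟩ ↦ |x⟩|c + H x⟩`, as a map of amplitude functions. -/
def oracleQuery {X C W : Type} [AddCommGroup C] (H : X → C) (ψ : (X × C) × W → ℂ) :
    (X × C) × W → ℂ :=
  fun s => ψ ((s.1.1, s.1.2 - H s.1.1), s.2)

section NRA

variable {κ N q : ℕ} {PK Msg X C : Type} {Sig : KeyRing κ PK → Type}
  [Fintype X] [DecidableEq X] [Fintype C] [DecidableEq C]

/-- The state after `k` queries and the unitary that follows them. -/
noncomputable def NRAAdversary.state [AddCommGroup C] (A : NRAAdversary N q Msg Sig X C)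
    (pk : Fin N → PK) (H : X → C) : ℕ → ((X × C) × A.Work → ℂ)
  | 0 => Matrix.mulVec (A.step pk 0 : Matrix _ _ ℂ) (Pi.single A.start 1)
  | k + 1 => Matrix.mulVec (A.step pk (k + 1) : Matrix _ _ ℂ) (oracleQuery H (A.state pk H k))

/-- A forgery wins if all members of its ring are among the given keys and it verifies. -/
def RingSignature.Wins {SK : Type} (RS : RingSignature κ PK SK Msg Sig X C)
    (pk : Fin N → PK) (H : X → C) (f : Forgery Msg Sig) : Prop :=
  (∀ j, f.1.2 j ∈ Set.range pk) ∧ RS.verify H f.1 f.2.1 f.2.2 = true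

open Classical in
/-- The advantage: `N` independent keys are generated, `H` is a uniformly random function, the
adversary is run on the public keys with quantum access to `H`, and its forgery is checked. -/
noncomputable def ufnraAdvantage [Fintype PK] [AddCommGroup C] {SK : Type}
    (RS : RingSignature κ PK SK Msg Sig X C) (A : NRAAdversary N q Msg Sig X C) : ℝ :=
  ∑ pk : Fin N → PK, (iidPMF (RS.keyGen.map Prod.fst) N pk).toReal *
    ((Fintype.card (X → C) : ℝ)⁻¹ * ∑ H : X → C,
      ∑ s : (X × C) × A.Work, if RS.Wins pk H (A.out s) then ‖A.state pk H q s‖ ^ 2 else 0)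

end NRA

/-! ## Impersonation under passive attacks -/

/-- A two-stage quantum impersonation adversary with classical coins.  On an instance, the first
stage applies `commit` to a basis state and measures the commitment `com`; the second stage gets
the post-measurement state and the challenge, applies `respond`, measures, and outputs `rsp`. -/
structure ImpAdversary (Inst Com Chal Rsp : Type) where
  Coin : Type
  [fintypeCoin : Fintype Coin]
  coin : PMF Coin
  Space : Type
  [fintypeSpace : Fintype Space]
  [decEqSpace : DecidableEq Space]
  start : Space
  commit : Coin → Inst → Matrix.unitaryGroup Space ℂ
  com : Space → Com
  respond : Coin → Inst → Chal → Matrix.unitaryGroup Space ℂ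
  rsp : Coin → Inst → Chal → Space → Rsp

attribute [instance] ImpAdversary.fintypeCoin ImpAdversary.fintypeSpace ImpAdversary.decEqSpace

open Classical in
/-- The unnormalised state after the first stage in the event that the commitment is `c`. -/
noncomputable def ImpAdversary.committed {Inst Com Chal Rsp : Type}
    (B : ImpAdversary Inst Com Chal Rsp) (ω : B.Coin) (x : Inst) (c : Com) : B.Space → ℂ :=
  fun s => if B.com s = c then
    Matrix.mulVec (B.commit ω x : Matrix _ _ ℂ) (Pi.single B.start 1) s else 0

/-- The probability that the honest verifier, who sends a uniformly random challenge, accepts. -/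
noncomputable def impAdvantage {Inst Wit St Com Chal Rsp : Type} [Fintype Inst] [Fintype Com]
    [Fintype Chal] (S : SigmaProtocol Inst Wit St Com Chal Rsp)
    (B : ImpAdversary Inst Com Chal Rsp) : ℝ :=
  ∑ x : Inst, (S.instDist x).toReal * ∑ ω : B.Coin, (B.coin ω).toReal *
    ∑ c : Com, ((Fintype.card Chal : ℝ)⁻¹ * ∑ ch : Chal, ∑ s : B.Space,
      if S.verify x c ch (B.rsp ω x ch s) = true then
        ‖Matrix.mulVec (B.respond ω x ch : Matrix _ _ ℂ) (B.committed ω x c) s‖ ^ 2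
      else 0)

/-! ## Black-box reductions -/

/-- The unitary on `ι × o` that applies `U k` to the first register when the second is `k`. -/
noncomputable def controlled {ι o : Type} [Fintype ι] [DecidableEq ι] [Fintype o] [DecidableEq o]
    (U : o → Matrix.unitaryGroup ι ℂ) : Matrix.unitaryGroup (ι × o) ℂ :=
  ⟨Matrix.blockDiagonal fun k => (U k : Matrix ι ι ℂ), by
    rw [Matrix.mem_unitaryGroup_iff, Matrix.star_eq_conjTranspose,
      Matrix.blockDiagonal_conjTranspose, ← Matrix.blockDiagonal_mul]
    have h : (fun k => (U k : Matrix ι ι ℂ) * (U k : Matrix ι ι ℂ).conjTranspose) = 1 := by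
      funext k
      exact Matrix.mem_unitaryGroup_iff.mp (U k).2
    rw [h, Matrix.blockDiagonal_one]⟩

/-- Renaming the basis along a bijection. -/
noncomputable def relabel {ι o : Type} [Fintype ι] [DecidableEq ι] [Fintype o] [DecidableEq o]
    (e : ι ≃ o) (U : Matrix.unitaryGroup ι ℂ) : Matrix.unitaryGroup o ℂ :=
  ⟨Matrix.reindex e e (U : Matrix ι ι ℂ), by
    rw [Matrix.mem_unitaryGroup_iff, Matrix.star_eq_conjTranspose, Matrix.reindex_apply,
      Matrix.conjTranspose_submatrix, Matrix.submatrix_mul_equiv]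
    have h : (U : Matrix ι ι ℂ) * (U : Matrix ι ι ℂ).conjTranspose = 1 :=
      Matrix.mem_unitaryGroup_iff.mp U.2
    rw [h, Matrix.submatrix_one_equiv]⟩

/-- What a reduction knows classically at the start: its own coins, the instance it is challenged
on, and `N` further instances freshly drawn from the generator. -/
abbrev View (N : ℕ) (Inst Coin : Type) : Type := Coin × Inst × (Fin N → Inst)

/-- A black-box reduction from forging (`N` keys, `q` queries to an oracle `X → C`) to
impersonation.  It passes the key vector `keys` to the forger and runs the forger's unitaries
`0, …, q` in this order, once before it sends its commitment and once more after it has received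
the challenge, where in each of the two passes the call of unitary `k` happens only if its own
memory says so (`run₁`, `run₂`).  After each call, in particular instead of each oracle query, it
applies a gate to the query register, the answer register and its memory; the forger's work
register it cannot touch, except that at the end of a pass it may read the forger's output.
None of these data may depend on the forger or on the Sigma protocol. -/
structure BlackBoxReduction {κ : ℕ} (N q : ℕ) (Inst Com Chal Rsp Msg : Type)
    (Sig : KeyRing κ Inst → Type) (X : Type) [Fintype X] [DecidableEq X] [Fintype Chal]
    [DecidableEq Chal] where
  Coin : Type
  [fintypeCoin : Fintype Coin]
  coin : PMF Coin
  Mem : Type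
  [fintypeMem : Fintype Mem]
  [decEqMem : DecidableEq Mem]
  start : Mem
  keys : View N Inst Coin → (Fin N → Inst)
  run₁ : View N Inst Coin → ℕ → Mem → Bool
  gate₁ : View N Inst Coin → ℕ → Matrix.unitaryGroup ((X × Chal) × Mem) ℂ
  read₁ : View N Inst Coin → Forgery Msg Sig → Matrix.unitaryGroup Mem ℂ
  com : Mem → Com
  run₂ : View N Inst Coin → Chal → ℕ → Mem → Bool
  gate₂ : View N Inst Coin → Chal → ℕ → Matrix.unitaryGroup ((X × Chal) × Mem) ℂ
  rsp : View N Inst Coin → Chal → Forgery Msg Sig → Mem → Rsp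

attribute [instance] BlackBoxReduction.fintypeCoin BlackBoxReduction.fintypeMem
  BlackBoxReduction.decEqMem

section Red

variable {κ N q : ℕ} {Inst Com Chal Rsp Msg X : Type} {Sig : KeyRing κ Inst → Type}
  [Fintype X] [DecidableEq X] [Fintype Chal] [DecidableEq Chal]

/-- Apply the forger's `k`-th unitary if the memory satisfies `run`. -/
noncomputable def NRAAdversary.call (A : NRAAdversary N q Msg Sig X Chal) {Mem : Type}
    [Fintype Mem] [DecidableEq Mem] (pk : Fin N → Inst) (k : ℕ) (run : Mem → Bool) :
    Matrix.unitaryGroup (((X × Chal) × A.Work) × Mem) ℂ :=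
  controlled fun m => if run m then A.step pk k else 1

/-- Apply a gate to the query and answer registers and the memory. -/
noncomputable def NRAAdversary.localGate (A : NRAAdversary N q Msg Sig X Chal) {Mem : Type}
    [Fintype Mem] [DecidableEq Mem] (G : Matrix.unitaryGroup ((X × Chal) × Mem) ℂ) :
    Matrix.unitaryGroup (((X × Chal) × A.Work) × Mem) ℂ :=
  relabel ⟨fun p => ((p.1.1, p.2), p.1.2), fun p => ((p.1.1, p.2), p.1.2),
      fun _ => rfl, fun _ => rfl⟩
    (controlled fun _ : A.Work => G)

/-- Apply to the memory a unitary that is selected by the forger's output. -/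
noncomputable def NRAAdversary.readOut (A : NRAAdversary N q Msg Sig X Chal) {Mem : Type}
    [Fintype Mem] [DecidableEq Mem] (G : Forgery Msg Sig → Matrix.unitaryGroup Mem ℂ) :
    Matrix.unitaryGroup (((X × Chal) × A.Work) × Mem) ℂ :=
  relabel (Equiv.prodComm _ _) (controlled fun a : (X × Chal) × A.Work => G (A.out a))

/-- The first `n` rounds of a pass: call of the forger's unitary, then a gate. -/
noncomputable def NRAAdversary.pass (A : NRAAdversary N q Msg Sig X Chal) {Mem : Type}
    [Fintype Mem] [DecidableEq Mem] (pk : Fin N → Inst) (run : ℕ → Mem → Bool)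
    (gate : ℕ → Matrix.unitaryGroup ((X × Chal) × Mem) ℂ) :
    ℕ → Matrix.unitaryGroup (((X × Chal) × A.Work) × Mem) ℂ
  | 0 => 1
  | n + 1 => A.localGate (gate n) * A.call pk n (run n) * A.pass pk run gate n

/-- The impersonation adversary that a reduction makes out of a forger.  Of the Sigma protocol it
only gets samples of the instance distribution `D`. -/
noncomputable def BlackBoxReduction.toImpAdversary [Fintype Inst]
    (R : BlackBoxReduction N q Inst Com Chal Rsp Msg Sig X)
    (D : PMF Inst) (A : NRAAdversary N q Msg Sig X Chal) : ImpAdversary Inst Com Chal Rsp where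
  Coin := R.Coin × (Fin N → Inst)
  coin := R.coin.bind fun ω => (iidPMF D N).map fun v => (ω, v)
  Space := ((X × Chal) × A.Work) × R.Mem
  start := (A.start, R.start)
  commit ω x :=
    let v : View N Inst R.Coin := (ω.1, x, ω.2)
    A.readOut (R.read₁ v) * A.pass (R.keys v) (R.run₁ v) (R.gate₁ v) (q + 1)
  com s := R.com s.2
  respond ω x ch :=
    let v : View N Inst R.Coin := (ω.1, x, ω.2)
    A.pass (R.keys v) (R.run₂ v ch) (R.gate₂ v ch) (q + 1)
  rsp ω x ch s := R.rsp (ω.1, x, ω.2) ch (A.out s.1) s.2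

end Red

/-! The proof is a measure-and-reprogram argument on the purified oracle: the reduction keeps the
function table of `H` in uniform superposition in its memory. For a point `x`, averaging over the
table entry at `x` projects onto states in which this entry is uncorrelated with everything else.
The averaging commutes with the forger's unitaries, and with a query except where the query hits
`x`. Telescoping along a run, one minus the averaging equals the sum, over all times, of the runs
whose query at that time is replaced by the commutator of query and averaging
(`scheduledRun_sub_average`).

Apply this to the `n` distinct points that verification of a given forgery hashes. The final state
becomes a sum of at most `q ^ n` runs with commutators at all `n` points at distinct times
(`centre_scheduledRun`), plus `n` remainders, each independent of the table entry at one of the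
points (`exists_eq_centre_add_sum`). Cauchy–Schwarz costs the factor `q ^ n + n`
(`sum_norm_run_sq_le`).

For a remainder the challenge of one ring position is as good as fresh, so the forger can be run to
its end, the commitment of its forgery sent, and the challenge of the verifier used in place of the
hash value. For a scheduled run the queries at the scheduled times are measured. Take the position
`l` whose point is queried last: its commitment is part of the hash input of position `l + 1`, hence
has been read by the time of that last query, whose answer can then be reprogrammed to the
challenge. For each fixed new entry the commutator has squared norm at most two over the number of
challenges (`sum_norm_commutator_sq_le`). So, divided by `√2`, restricted to the entry given by the
challenge and rescaled by the root of the number of challenges, it is still a contraction; the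
rescaling cancels the probability of the challenge, and each measured query costs only a factor `2`.

All these operations are contractions. Each is dilated to a unitary with a flag value of its own,
and only amplitude on flag value `0` is counted, so a single forward run of the forger, split
between the two passes, suffices. The reduction guesses the index of its instance among the `N` keys
and the times of the queries; `loss_le` collects the factors. -/

set_option linter.unusedSectionVars false

/-! ## The purified random oracle -/

section Purified

variable {X C W : Type} [Fintype X] [DecidableEq X] [Fintype C] [DecidableEq C] [AddCommGroup C]

/-- Families of amplitude functions indexed by the function table of the oracle. -/
abbrev PurifiedAmp (X C W : Type) : Type := (X → C) → (X × C) × W → ℂ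

/-- Averaging over the value of the oracle at `x`. -/
noncomputable def average (x : X) : PurifiedAmp X C W →ₗ[ℂ] PurifiedAmp X C W where
  toFun ψ H s := (Fintype.card C : ℂ)⁻¹ * ∑ c, ψ (Function.update H x c) s
  map_add' ψ φ := by
    funext H s
    simp [Finset.sum_add_distrib, mul_add]
  map_smul' a ψ := by
    funext H s
    simp [← Finset.mul_sum, mul_left_comm]

/-- The oracle query, controlled by the function table. -/
def purifiedQuery : PurifiedAmp X C W →ₗ[ℂ] PurifiedAmp X C W where
  toFun ψ H := oracleQuery H (ψ H)
  map_add' _ _ := rfl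
  map_smul' _ _ := rfl

/-- The commutator of the oracle query and the averaging at `x`. -/
noncomputable def queryCommutator (x : X) : PurifiedAmp X C W →ₗ[ℂ] PurifiedAmp X C W where
  toFun ψ H s := if s.1.1 = x then
    purifiedQuery (average x ψ) H s - average x (purifiedQuery ψ) H s else 0
  map_add' ψ φ := by
    funext H s
    simp only [map_add, Pi.add_apply]
    split_ifs <;> ring
  map_smul' a ψ := by
    funext H s
    simp only [map_smul, Pi.smul_apply, smul_eq_mul, RingHom.id_apply]
    split_ifs <;> ring

/-- A family of matrices on the registers, applied independently of the function table. -/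
noncomputable def applyMatrix [Fintype W] (U : Matrix ((X × C) × W) ((X × C) × W) ℂ) :
    PurifiedAmp X C W →ₗ[ℂ] PurifiedAmp X C W where
  toFun ψ H := U.mulVec (ψ H)
  map_add' _ _ := by
    funext H
    exact Matrix.mulVec_add _ _ _
  map_smul' a ψ := by
    funext H
    exact Matrix.mulVec_smul U a (ψ H)

theorem average_apply (x : X) (ψ : PurifiedAmp X C W) (H : X → C) (s : (X × C) × W) :
    average x ψ H s = (Fintype.card C : ℂ)⁻¹ * ∑ c, ψ (Function.update H x c) s := rfl

theorem purifiedQuery_apply (ψ : PurifiedAmp X C W) (H : X → C) (s : (X × C) × W) :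
    purifiedQuery ψ H s = ψ H ((s.1.1, s.1.2 - H s.1.1), s.2) := rfl

theorem queryCommutator_apply (x : X) (ψ : PurifiedAmp X C W) (H : X → C) (s : (X × C) × W) :
    queryCommutator x ψ H s = if s.1.1 = x then
      (Fintype.card C : ℂ)⁻¹ * ∑ c, (ψ (Function.update H x c) ((x, s.1.2 - H x), s.2) -
        ψ (Function.update H x c) ((x, s.1.2 - c), s.2)) else 0 := by
  simp only [queryCommutator, LinearMap.coe_mk, AddHom.coe_mk]
  split_ifs with h
  · subst h
    simp [average_apply, purifiedQuery_apply, mul_sub]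
  · rfl

/-- A query at a point other than `x` reads a table entry that the averaging leaves alone, so the
whole commutator lives on query inputs equal to `x`. This is why a commutator can be implemented by
measuring the query. -/
theorem purifiedQuery_average (x : X) (ψ : PurifiedAmp X C W) :
    purifiedQuery (average x ψ) = average x (purifiedQuery ψ) + queryCommutator x ψ := by
  funext H s
  simp only [Pi.add_apply, queryCommutator, LinearMap.coe_mk, AddHom.coe_mk]
  split_ifs with h
  · ring
  · simp [average_apply, purifiedQuery_apply, Function.update_of_ne h]

/-- The commutator at `y` reads and changes only the table entry at `y`; averaging at another point
does not see it. -/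
theorem queryCommutator_average {x y : X} (hxy : x ≠ y) (ψ : PurifiedAmp X C W) :
    queryCommutator y (average x ψ) = average x (queryCommutator y ψ) := by
  funext H s
  rw [average_apply]
  simp only [queryCommutator_apply]
  split_ifs with h
  · simp only [average_apply, Function.update_of_ne hxy.symm, Finset.mul_sum,
      ← mul_sub, ← Finset.sum_sub_distrib]
    rw [Finset.sum_comm]
    simp only [Function.update_comm hxy, mul_sub]
  · simp

theorem applyMatrix_average [Fintype W] (U : Matrix ((X × C) × W) ((X × C) × W) ℂ)
    (x : X) (ψ : PurifiedAmp X C W) :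
    applyMatrix U (average x ψ) = average x (applyMatrix U ψ) := by
  funext H s
  simp only [applyMatrix, LinearMap.coe_mk, AddHom.coe_mk, average_apply, Matrix.mulVec,
    dotProduct, Finset.mul_sum]
  rw [Finset.sum_comm]
  simp only [mul_left_comm]

/-- The oracle query, or its commutator with the averaging at a given point. -/
noncomputable def scheduledQuery : Option X → PurifiedAmp X C W →ₗ[ℂ] PurifiedAmp X C W
  | none => purifiedQuery
  | some x => queryCommutator x

/-- The state before the `k`-th unitary, when the `i`-th query is replaced by
`scheduledQuery (τ i)`. -/
noncomputable def scheduledRun [Fintype W] (U : ℕ → Matrix ((X × C) × W) ((X × C) × W) ℂ)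
    (init : (X × C) × W → ℂ) (τ : ℕ → Option X) : ℕ → PurifiedAmp X C W
  | 0 => fun _ => init
  | k + 1 => scheduledQuery (τ k) (applyMatrix (U k) (scheduledRun U init τ k))

variable [Fintype W] (U : ℕ → Matrix ((X × C) × W) ((X × C) × W) ℂ) (init : (X × C) × W → ℂ)

theorem scheduledRun_congr {τ τ' : ℕ → Option X} {k : ℕ} (h : ∀ i < k, τ i = τ' i) :
    scheduledRun U init τ k = scheduledRun U init τ' k := by
  induction k with
  | zero => rfl
  | succ k ih =>
    rw [scheduledRun, scheduledRun, h k k.lt_succ_self,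
      ih fun i hi => h i (hi.trans k.lt_succ_self)]

/-- The part of a run in which the oracle value at `x` is correlated with the registers is the sum,
over the free times, of the runs with a commutator at that time. -/
theorem scheduledRun_sub_average {τ : ℕ → Option X} {x : X} (hx : ∀ i, τ i ≠ some x) (k : ℕ) :
    scheduledRun U init τ k - average x (scheduledRun U init τ k) =
      ∑ i ∈ (Finset.range k).filter fun i => τ i = none,
        scheduledRun U init (Function.update τ i (some x)) k := by
  induction k with
  | zero =>
    -- The initial amplitudes do not depend on the table, so averaging fixes them and there is no
    -- time to sum over.
    funext H s
    have : (Fintype.card C : ℂ) ≠ 0 := by simp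
    simp [scheduledRun, average_apply, this]
  | succ k ih =>
    have hstep : ∀ i ∈ (Finset.range k).filter fun i => τ i = none,
        scheduledRun U init (Function.update τ i (some x)) (k + 1) =
          scheduledQuery (τ k) (applyMatrix (U k)
            (scheduledRun U init (Function.update τ i (some x)) k)) := by
      intro i hi
      have : k ≠ i := by
        rintro rfl
        simp at hi
      rw [scheduledRun, Function.update_of_ne this]
    have hlast : scheduledRun U init (Function.update τ k (some x)) (k + 1) =
        queryCommutator x (applyMatrix (U k) (scheduledRun U init τ k)) := by
      rw [scheduledRun, Function.update_self,
        scheduledRun_congr U init (τ := Function.update τ k (some x)) (τ' := τ) fun i hi =>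
          Function.update_of_ne hi.ne _ _]
      rfl
    -- By linearity the earlier commutators are carried through one more round; what remains is to
    -- move the averaging past the query at time `k`.
    have hsum : scheduledQuery (τ k) (applyMatrix (U k) (scheduledRun U init τ k)) -
        scheduledQuery (τ k) (average x (applyMatrix (U k) (scheduledRun U init τ k))) =
        ∑ i ∈ (Finset.range k).filter fun i => τ i = none,
          scheduledRun U init (Function.update τ i (some x)) (k + 1) := by
      rw [Finset.sum_congr rfl hstep, ← map_sum, ← map_sum, ← ih, map_sub, map_sub,
        applyMatrix_average]
    rw [Finset.range_add_one, Finset.filter_insert]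
    cases hk : τ k with
    | none =>
      -- At a free time, moving the averaging past the query leaves exactly the commutator term,
      -- which is the new summand `i = k`.
      rw [if_pos rfl, Finset.sum_insert (by simp), hlast, ← hsum, scheduledRun, hk]
      simp only [scheduledQuery]
      rw [purifiedQuery_average]
      abel
    | some y =>
      -- At an occupied time the commutator belongs to a different point and lets the averaging
      -- pass, so no summand is added.
      have hyx : x ≠ y := fun h => hx k (h ▸ hk)
      rw [if_neg (by simp), ← hsum, scheduledRun, hk]
      simp only [scheduledQuery]
      rw [queryCommutator_average hyx]

/-- The schedule that puts the point `x j` at time `t j`. -/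
noncomputable def schedule {n q : ℕ} (x : Fin n → X) (t : Fin n → Fin q) (i : ℕ) : Option X :=
  open Classical in if h : ∃ j, (t j : ℕ) = i then some (x h.choose) else none

theorem schedule_apply {n q : ℕ} (x : Fin n → X) {t : Fin n → Fin q} (ht : Function.Injective t)
    (j : Fin n) : schedule x t (t j) = some (x j) := by
  have h : ∃ j', (t j' : ℕ) = t j := ⟨j, rfl⟩
  rw [schedule, dif_pos h]
  exact congrArg (fun j => some (x j)) (ht (Fin.ext h.choose_spec))

theorem schedule_eq_none {n q : ℕ} {x : Fin n → X} {t : Fin n → Fin q} {i : ℕ} :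
    schedule x t i = none ↔ ∀ j, (t j : ℕ) ≠ i := by
  rw [schedule]
  split_ifs with h <;> simpa using h

theorem schedule_cons {n q : ℕ} (x₀ : X) (x : Fin n → X) (k : Fin q) {t : Fin n → Fin q}
    (ht : Function.Injective (Fin.cons k t : Fin (n + 1) → Fin q)) :
    schedule (Fin.cons x₀ x : Fin (n + 1) → X) (Fin.cons k t : Fin (n + 1) → Fin q) =
      Function.update (schedule x t) k (some x₀) := by
  funext i
  have ht' := (Fin.cons_injective_iff.mp ht).2
  by_cases h : ∃ j, ((Fin.cons k t : Fin (n + 1) → Fin q) j : ℕ) = i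
  · obtain ⟨j, rfl⟩ := h
    rw [schedule_apply _ ht]
    refine Fin.cases ?_ (fun j => ?_) j
    · simp
    · have hne : t j ≠ k := fun h => (Fin.cons_injective_iff.mp ht).1 ⟨j, h⟩
      simp only [Fin.cons_succ]
      rw [Function.update_of_ne (fun h => hne (Fin.ext h)), schedule_apply _ ht']
  · push Not at h
    rw [schedule_eq_none.mpr h, Function.update_of_ne (by simpa using (h 0).symm), eq_comm,
      schedule_eq_none]
    exact fun j => by simpa using h j.succ

/-- Subtract the average at each of the given points. -/
noncomputable def centre : {n : ℕ} → (Fin n → X) → PurifiedAmp X C W → PurifiedAmp X C W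
  | 0, _, ψ => ψ
  | _ + 1, x, ψ => centre (Fin.tail x) ψ - average (x 0) (centre (Fin.tail x) ψ)

-- Each centring inserts one more commutator at a time that is still free. Since the points are
-- distinct, commutators inserted earlier commute with the next averaging, and the choices of
-- successive free times are exactly the injective maps.
open Classical in
theorem centre_scheduledRun {n : ℕ} {x : Fin n → X} (hx : Function.Injective x) (q : ℕ) :
    centre x (scheduledRun U init (fun _ => none) q) =
      ∑ t : Fin n → Fin q with Function.Injective t, scheduledRun U init (schedule x t) q := by
  induction n with
  | zero =>
    have : (Finset.univ.filter fun t : Fin 0 → Fin q => Function.Injective t) = Finset.univ :=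
      Finset.filter_true_of_mem fun t _ => Function.injective_of_subsingleton t
    rw [this, Fintype.sum_unique, centre]
    congr 1
  | succ n ih =>
    obtain ⟨x₀, x, rfl⟩ : ∃ x₀ x', x = Fin.cons x₀ x' :=
      ⟨x 0, Fin.tail x, (Fin.cons_self_tail x).symm⟩
    obtain ⟨hx₀, hx'⟩ := Fin.cons_injective_iff.mp hx
    rw [centre, Fin.tail_cons, Fin.cons_zero, ih hx', map_sum, ← Finset.sum_sub_distrib]
    rw [Finset.sum_congr rfl fun t _ => scheduledRun_sub_average U init
      (τ := schedule x t) (x := x₀) (fun i h => ?_) q]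
    · rw [Finset.sum_filter, Finset.sum_filter,
        ← (Fin.consEquiv fun _ : Fin (n + 1) => Fin q).sum_comp, Fintype.sum_prod_type,
        Finset.sum_comm]
      refine Finset.sum_congr rfl fun t _ => ?_
      change _ = ∑ k, if Function.Injective (Fin.cons k t : Fin (n + 1) → Fin q) then
        scheduledRun U init (schedule (Fin.cons x₀ x : Fin (n + 1) → X)
          (Fin.cons k t : Fin (n + 1) → Fin q)) q else 0
      split_ifs with ht
      · rw [Finset.sum_filter, Finset.sum_range]
        refine Finset.sum_congr rfl fun k _ => ?_
        -- Being free for the new point means being different from all times in `t`, which is the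
        -- injectivity of the extended tuple.
        have hiff : schedule x t k = none ↔
            Function.Injective (Fin.cons k t : Fin (n + 1) → Fin q) := by
          rw [schedule_eq_none, Fin.cons_injective_iff]
          simp [ht, Fin.ext_iff]
        by_cases hk : Function.Injective (Fin.cons k t : Fin (n + 1) → Fin q)
        · rw [if_pos (hiff.mpr hk), if_pos hk, schedule_cons _ _ _ hk]
        · rw [if_neg (hiff.not.mpr hk), if_neg hk]
      · refine (Finset.sum_eq_zero fun k _ => if_neg fun h => ht ?_).symm
        exact (Fin.cons_injective_iff.mp h).2
    · rw [schedule] at h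
      split_ifs at h
      exact hx₀ ⟨_, Option.some_injective _ h⟩

end Purified

/-! ## Norm estimates for averaging and for the commutator -/

section Norms

variable {X C W : Type} [Fintype X] [DecidableEq X] [Fintype C] [DecidableEq C] [AddCommGroup C]

/-- Exchanging the entry at `x` with the fresh value is an involution on pairs of a table and a
value. -/
theorem sum_sum_update {M : Type*} [AddCommMonoid M] (x : X) (f : (X → C) → M) :
    ∑ H : X → C, ∑ c, f (Function.update H x c) = Fintype.card C • ∑ H, f H := by
  let e : (X → C) × C ≃ (X → C) × C :=
    { toFun := fun p => (Function.update p.1 x p.2, p.1 x)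
      invFun := fun p => (Function.update p.1 x p.2, p.1 x)
      left_inv := fun p => by simp
      right_inv := fun p => by simp }
  rw [← Fintype.sum_prod_type', show ∑ p : (X → C) × C, f (Function.update p.1 x p.2) =
    ∑ p : (X → C) × C, f p.1 from e.sum_comp fun p => f p.1, Fintype.sum_prod_type]
  simp [Finset.sum_nsmul]

theorem sum_eq_sum_update (x : X) (f : (X → C) → ℝ) :
    ∑ H : X → C, f H = (Fintype.card C : ℝ)⁻¹ * ∑ H, ∑ c, f (Function.update H x c) := by
  have : (Fintype.card C : ℝ) ≠ 0 := by simp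
  rw [sum_sum_update, nsmul_eq_mul, inv_mul_cancel_left₀ this]

/-- Pythagoras for the mean and the deviation from it. Both parts being bounded by the total makes
averaging and its complement contractions. -/
theorem sum_norm_sub_mean_sq (a : C → ℂ) :
    ∑ c, ‖a c - (Fintype.card C : ℂ)⁻¹ * ∑ c', a c'‖ ^ 2 +
      Fintype.card C * ‖(Fintype.card C : ℂ)⁻¹ * ∑ c', a c'‖ ^ 2 = ∑ c, ‖a c‖ ^ 2 := by
  have hM : (Fintype.card C : ℂ) ≠ 0 := by simp
  set m := (Fintype.card C : ℂ)⁻¹ * ∑ c', a c' with hm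
  have hs : ∑ c', a c' = Fintype.card C * m := by rw [hm, mul_inv_cancel_left₀ hM]
  have h : ∑ c, 2 * (a c * (starRingEnd ℂ) m).re = 2 * (Fintype.card C * Complex.normSq m) := by
    rw [← Finset.mul_sum, ← Complex.re_sum, ← Finset.sum_mul, hs, mul_assoc, Complex.mul_conj]
    norm_cast
  simp only [Complex.sq_norm, Complex.normSq_sub, Finset.sum_sub_distrib, Finset.sum_add_distrib, h]
  simp
  ring

theorem card_mul_norm_mean_sq_le (a : C → ℂ) :
    Fintype.card C * ‖(Fintype.card C : ℂ)⁻¹ * ∑ c', a c'‖ ^ 2 ≤ ∑ c, ‖a c‖ ^ 2 := by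
  rw [← sum_norm_sub_mean_sq a]
  exact le_add_of_nonneg_left (by positivity)

theorem sum_norm_average_sq_le (x : X) (ψ : PurifiedAmp X C W) (s : (X × C) × W) :
    ∑ H, ‖average x ψ H s‖ ^ 2 ≤ ∑ H, ‖ψ H s‖ ^ 2 := by
  have hM : (0 : ℝ) < Fintype.card C := by simp [Fintype.card_pos]
  rw [sum_eq_sum_update x fun H => ‖ψ H s‖ ^ 2, Finset.mul_sum]
  refine Finset.sum_le_sum fun H _ => ?_
  rw [le_inv_mul_iff₀ hM]
  exact card_mul_norm_mean_sq_le fun c => ψ (Function.update H x c) s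

theorem sum_norm_sub_average_sq_le (x : X) (ψ : PurifiedAmp X C W) (s : (X × C) × W) :
    ∑ H, ‖(ψ - average x ψ) H s‖ ^ 2 ≤ ∑ H, ‖ψ H s‖ ^ 2 := by
  rw [sum_eq_sum_update x fun H => ‖(ψ - average x ψ) H s‖ ^ 2,
    sum_eq_sum_update x fun H => ‖ψ H s‖ ^ 2]
  refine mul_le_mul_of_nonneg_left (Finset.sum_le_sum fun H _ => ?_) (by positivity)
  rw [← sum_norm_sub_mean_sq fun c => ψ (Function.update H x c) s]
  simp only [Pi.sub_apply, average_apply, Function.update_idem]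
  exact le_add_of_nonneg_right (by positivity)

theorem average_update (x : X) (ψ : PurifiedAmp X C W) (H : X → C) (c : C) :
    average x ψ (Function.update H x c) = average x ψ H := by
  funext s
  simp [average_apply]

theorem sum_norm_centre_sq_le {n : ℕ} (x : Fin n → X) (ψ : PurifiedAmp X C W)
    (s : (X × C) × W) : ∑ H, ‖centre x ψ H s‖ ^ 2 ≤ ∑ H, ‖ψ H s‖ ^ 2 := by
  induction n with
  | zero => exact le_rfl
  | succ n ih => exact (sum_norm_sub_average_sq_le _ _ _).trans (ih _)

/-- What is lost by centring is a sum of contributions that do not depend on the oracle value at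
one of the points. -/
theorem exists_eq_centre_add_sum {n : ℕ} (x : Fin n → X) (ψ : PurifiedAmp X C W) :
    ∃ g : Fin n → PurifiedAmp X C W,
      (∀ j H c, g j (Function.update H (x j) c) = g j H) ∧
      (∀ j s, ∑ H, ‖g j H s‖ ^ 2 ≤ ∑ H, ‖ψ H s‖ ^ 2) ∧
      ψ = centre x ψ + ∑ j, g j := by
  induction n with
  | zero => exact ⟨Fin.elim0, fun j => j.elim0, fun j => j.elim0, by simp [centre]⟩
  | succ n ih =>
    obtain ⟨g, hg₁, hg₂, hg₃⟩ := ih (Fin.tail x)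
    -- Each centring splits off an average, which is constant in the entry at its point. Averaging
    -- and the earlier centrings do not increase the norm, for each register state separately.
    refine ⟨Fin.cons (average (x 0) (centre (Fin.tail x) ψ)) g, fun j => ?_, fun j => ?_, ?_⟩
    · refine Fin.cases (fun H c => ?_) (fun j => ?_) j
      · simp only [Fin.cons_zero, average_update]
      · exact hg₁ j
    · refine Fin.cases (fun s => ?_) (fun j => ?_) j
      · exact (sum_norm_average_sq_le _ _ _).trans (sum_norm_centre_sq_le _ _ _)
      · exact hg₂ j
    · rw [Fin.sum_univ_succ]
      simp only [Fin.cons_zero, Fin.cons_succ, centre]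
      nth_rw 1 [hg₃]
      abel

/-- The left side is the squared norm of the adjoint of the commutator (with the new entry fixed to
`θ`, without the normalisation) applied to `k`. Expanding the square, the cross terms sum to the
squared modulus of the total of `k`, which enters with a negative sign. -/
theorem sum_norm_sub_shift_sq (k : C → ℂ) (θ : C) :
    ∑ c, ∑ y, ‖k (y + θ) - k (y + c)‖ ^ 2 =
      2 * Fintype.card C * ∑ y, ‖k y‖ ^ 2 - 2 * ‖∑ y, k y‖ ^ 2 := by
  have h1 : ∀ c : C, ∑ y, Complex.normSq (k (y + c)) = ∑ y, Complex.normSq (k y) := fun c =>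
    Equiv.sum_comp (Equiv.addRight c) fun y => Complex.normSq (k y)
  have h2 : ∑ c, ∑ y, (k (y + θ) * (starRingEnd ℂ) (k (y + c))).re =
      Complex.normSq (∑ y, k y) := by
    have h3 : ∀ y : C, ∑ c, k (y + c) = ∑ c, k c := fun y => Equiv.sum_comp (Equiv.addLeft y) k
    rw [Finset.sum_comm]
    simp only [← Complex.re_sum, ← Finset.mul_sum, ← map_sum, h3, ← Finset.sum_mul]
    rw [show ∑ y, k (y + θ) = ∑ y, k y from Equiv.sum_comp (Equiv.addRight θ) k, Complex.mul_conj, Complex.ofReal_re]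
  simp only [Complex.sq_norm, Complex.normSq_sub, Finset.sum_sub_distrib, Finset.sum_add_distrib,
    h1, ← Finset.mul_sum, h2]
  simp
  ring

/-- The adjoint relation between `g ↦ k` and `k ↦ k (y + θ) - k (y + c)`, evaluated at the image of
`g` itself. -/
theorem sum_mul_conj_commutator (g : C → C → ℂ) (θ : C) (k : C → ℂ)
    (hk : ∀ y, k y = ∑ c, (g c (y - θ) - g c (y - c))) :
    ∑ c, ∑ y, (g c y * (starRingEnd ℂ) (k (y + θ) - k (y + c))).re = ∑ y, ‖k y‖ ^ 2 := by
  have h1 : ∀ c θ : C, ∑ y, g c y * (starRingEnd ℂ) (k (y + θ)) =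
      ∑ y, g c (y - θ) * (starRingEnd ℂ) (k y) := fun c θ => by
    rw [← Equiv.sum_comp (Equiv.addRight θ) fun y => g c (y - θ) * (starRingEnd ℂ) (k y)]
    simp
  have h2 : ∀ y, ‖k y‖ ^ 2 = (∑ c, (g c (y - θ) * (starRingEnd ℂ) (k y) -
      g c (y - c) * (starRingEnd ℂ) (k y))).re := fun y => by
    simp only [← sub_mul, ← Finset.sum_mul]
    rw [← hk, Complex.mul_conj, Complex.ofReal_re, Complex.sq_norm]
  simp only [h2, ← Complex.re_sum]
  rw [Finset.sum_comm]
  congr 1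
  rw [Finset.sum_comm]
  simp only [map_sub, mul_sub, Finset.sum_sub_distrib, h1]
  congr 1 <;> exact Finset.sum_comm

/-- The norm of the commutator of the query and the averaging, for a fixed new oracle value. -/
theorem sum_norm_commutator_sq_le (g : C → C → ℂ) (θ : C) :
    ∑ y, ‖∑ c, (g c (y - θ) - g c (y - c))‖ ^ 2 ≤
      2 * Fintype.card C * ∑ c, ∑ y, ‖g c y‖ ^ 2 := by
  obtain ⟨k, hk⟩ : ∃ k : C → ℂ, ∀ y, k y = ∑ c, (g c (y - θ) - g c (y - c)) := ⟨_, fun _ => rfl⟩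
  obtain ⟨M, hM⟩ : ∃ M : ℝ, M = Fintype.card C := ⟨_, rfl⟩
  have hM0 : 0 < M := by simp [hM, Fintype.card_pos]
  simp only [← hk, ← hM]
  -- Writing `T` for the map from `g` to `k`, this is the squared norm of `2M g - T* T g`. It is
  -- `4M² ‖g‖² + ‖T* k‖² - 4M ‖k‖²`, and `‖T* k‖² ≤ 2M ‖k‖²` by the adjoint computation, so `‖k‖² ≤
  -- 2M ‖g‖²` without any appeal to operator norms.
  have h0 : 0 ≤ ∑ c, ∑ y, ‖((2 * M : ℝ) : ℂ) * g c y - (k (y + θ) - k (y + c))‖ ^ 2 := by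
    positivity
  have h1 : ∀ c y, ‖((2 * M : ℝ) : ℂ) * g c y - (k (y + θ) - k (y + c))‖ ^ 2 =
      (2 * M) ^ 2 * ‖g c y‖ ^ 2 + ‖k (y + θ) - k (y + c)‖ ^ 2 -
      4 * M * (g c y * (starRingEnd ℂ) (k (y + θ) - k (y + c))).re := fun c y => by
    rw [Complex.sq_norm, Complex.normSq_sub, Complex.normSq_mul, Complex.normSq_ofReal,
      mul_assoc (((2 * M : ℝ) : ℂ)),
      Complex.re_ofReal_mul, Complex.sq_norm, Complex.sq_norm]
    ring
  simp only [h1, Finset.sum_sub_distrib, Finset.sum_add_distrib, ← Finset.mul_sum] at h0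
  rw [sum_mul_conj_commutator g θ k hk, sum_norm_sub_shift_sq, ← hM] at h0
  have h2 : 0 ≤ ‖∑ y, k y‖ ^ 2 := by positivity
  generalize ∑ c, ∑ y, ‖g c y‖ ^ 2 = G at h0 ⊢
  generalize ∑ y, ‖k y‖ ^ 2 = S at h0 ⊢
  have h3 : 2 * M * S ≤ 2 * M * (2 * M * G) := by linarith
  exact le_of_mul_le_mul_left h3 (by positivity)

end Norms

/-! ## Dilating contractions to unitaries with a flag -/

section Dilation

variable {ι : Type} [Fintype ι] [DecidableEq ι]

/-- A linear map that does not increase the Euclidean norm. -/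
def IsContraction (L : (ι → ℂ) →ₗ[ℂ] (ι → ℂ)) : Prop :=
  ∀ φ, ∑ i, ‖L φ i‖ ^ 2 ≤ ∑ i, ‖φ i‖ ^ 2

theorem IsContraction.id : IsContraction (LinearMap.id : (ι → ℂ) →ₗ[ℂ] (ι → ℂ)) :=
  fun _ => le_rfl

theorem IsContraction.comp {L L' : (ι → ℂ) →ₗ[ℂ] (ι → ℂ)} (h : IsContraction L)
    (h' : IsContraction L') : IsContraction (L ∘ₗ L') :=
  fun φ => (h _).trans (h' φ)

theorem star_dotProduct_self_eq (x : ι → ℂ) : star x ⬝ᵥ x = ((∑ i, ‖x i‖ ^ 2 : ℝ) : ℂ) := by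
  simp only [dotProduct, Pi.star_apply, RCLike.star_def, Complex.ofReal_sum, Complex.conj_mul',
    Complex.ofReal_pow]

-- For a contraction `A` the matrix `1 - A* A` is positive semidefinite, hence of the form `B* B`.
-- Stacking `A` on `B` then gives an isometry.
open scoped ComplexOrder in
theorem IsContraction.exists_defect {L : (ι → ℂ) →ₗ[ℂ] (ι → ℂ)} (h : IsContraction L) :
    ∃ B : Matrix ι ι ℂ, (LinearMap.toMatrix' L).conjTranspose * LinearMap.toMatrix' L +
      B.conjTranspose * B = 1 := by
  set A := LinearMap.toMatrix' L with hA
  have hpsd : (1 - A.conjTranspose * A).PosSemidef := by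
    refine Matrix.PosSemidef.of_dotProduct_mulVec_nonneg
      (Matrix.isHermitian_one.sub (Matrix.isHermitian_conjTranspose_mul_self A)) fun x => ?_
    have h1 : star x ⬝ᵥ (A.conjTranspose * A).mulVec x = star (A.mulVec x) ⬝ᵥ A.mulVec x := by
      rw [Matrix.star_mulVec, ← Matrix.dotProduct_mulVec, Matrix.mulVec_mulVec]
    rw [Matrix.sub_mulVec, dotProduct_sub, Matrix.one_mulVec, h1, star_dotProduct_self_eq,
      star_dotProduct_self_eq, hA, LinearMap.toMatrix'_mulVec, ← Complex.ofReal_sub]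
    exact_mod_cast sub_nonneg.mpr (h x)
  open scoped MatrixOrder Matrix.Norms.L2Operator in
  obtain ⟨B, hB⟩ := CStarAlgebra.nonneg_iff_eq_star_mul_self.mp hpsd.nonneg
  refine ⟨B, ?_⟩
  rw [← Matrix.star_eq_conjTranspose B, ← hB]
  abel

variable {F : Type} [Fintype F] [DecidableEq F]

/-- A contraction is the compression of a unitary that moves amplitude from the flag value `o` to
the flag value `a` and acts trivially on all other flag values. -/
theorem IsContraction.exists_unitary {L : (ι → ℂ) →ₗ[ℂ] (ι → ℂ)} (h : IsContraction L)
    {o a : F} (hoa : o ≠ a) :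
    ∃ G : Matrix.unitaryGroup (ι × F) ℂ, ∀ Φ : ι × F → ℂ, (∀ u, Φ (u, a) = 0) →
      (∀ u, (G : Matrix _ _ ℂ).mulVec Φ (u, o) = L (fun v => Φ (v, o)) u) ∧
      ∀ b, b ≠ o → b ≠ a → ∀ u, (G : Matrix _ _ ℂ).mulVec Φ (u, b) = Φ (u, b) := by
  obtain ⟨B, hB⟩ := h.exists_defect
  set A := LinearMap.toMatrix' L with hA
  -- The intended columns: those of flag `o` consist of `A` in flag `o` and the defect `B` in flag
  -- `a`; the others are unit vectors. The columns of flag `a` are not used.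
  let w : ι × F → EuclideanSpace ℂ (ι × F) := fun p => WithLp.toLp 2 fun r =>
    if p.2 = o then if r.2 = o then A r.1 p.1 else if r.2 = a then B r.1 p.1 else 0
    else if r = p then 1 else 0
  let s : Set (ι × F) := {p | p.2 ≠ a}
  have hw : Orthonormal ℂ (s.domRestrict w) := by
    rw [orthonormal_iff_ite]
    rintro ⟨⟨v, b⟩, hb⟩ ⟨⟨v', b'⟩, hb'⟩
    simp only [s, Set.mem_ofPred_eq] at hb hb'
    have hinner : inner ℂ (w (v, b)) (w (v', b')) =
        ∑ r, w (v', b') r * (starRingEnd ℂ) (w (v, b) r) := by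
      rw [EuclideanSpace.inner_eq_star_dotProduct]
      rfl
    simp only [Set.domRestrict_apply, hinner, Subtype.mk.injEq, Prod.mk.injEq, w]
    by_cases h1 : b = o <;> by_cases h2 : b' = o
    · have h3 := congrFun (congrFun hB v) v'
      rw [Matrix.add_apply, Matrix.mul_apply, Matrix.mul_apply, Matrix.one_apply] at h3
      simp only [h1, h2, if_true, and_true]
      rw [← h3, Fintype.sum_prod_type_right]
      rw [Finset.sum_eq_add_of_mem o a (Finset.mem_univ _) (Finset.mem_univ _) hoa]
      · simp [hoa.symm, Matrix.conjTranspose_apply, mul_comm]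
      · rintro c - ⟨hc1, hc2⟩
        simp [hc1, hc2]
    · simp only [h1, h2, if_true, if_false, ite_mul, one_mul, zero_mul, Finset.sum_ite_eq',
        Finset.mem_univ, hb', map_zero]
      rw [if_neg fun h => h2 h.2.symm]
    · simp [h1, h2, hb]
    · simp only [h1, h2, if_false, ite_mul, one_mul, zero_mul, Finset.sum_ite_eq',
        Finset.mem_univ, if_true, Prod.mk.injEq]
      by_cases h3 : v = v' ∧ b = b'
      · rw [if_pos h3, if_pos ⟨h3.1.symm, h3.2.symm⟩, map_one]
      · rw [if_neg h3, if_neg fun h => h3 ⟨h.1.symm, h.2.symm⟩, map_zero]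
  -- The columns of flag `a` are filled in arbitrarily to complete an orthonormal basis; this is
  -- harmless because `Φ` vanishes on that flag.
  obtain ⟨b₀, hb₀⟩ := hw.exists_orthonormalBasis_extension_of_card_eq
    (by simp [finrank_euclideanSpace])
  refine ⟨⟨_, (EuclideanSpace.basisFun (ι × F) ℂ).toMatrix_orthonormalBasis_mem_unitary b₀⟩,
    fun Φ hΦ => ?_⟩
  have hG : ∀ r, Matrix.mulVec ((EuclideanSpace.basisFun (ι × F) ℂ).toBasis.toMatrix b₀) Φ r =
      ∑ c, ∑ v, w (v, c) r * Φ (v, c) := fun r => by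
    rw [Matrix.mulVec, dotProduct, Fintype.sum_prod_type_right]
    refine Finset.sum_congr rfl fun c _ => Finset.sum_congr rfl fun v _ => ?_
    rw [Module.Basis.toMatrix_apply]
    by_cases hc : c = a
    · rw [hc, hΦ, mul_zero, mul_zero]
    · rw [hb₀ (v, c) hc]
      rfl
  constructor
  · intro u
    rw [hG, Finset.sum_eq_single o, ← LinearMap.toMatrix'_mulVec, Matrix.mulVec, dotProduct]
    · simp [w, hA]
    · intro c _ hc
      refine Finset.sum_eq_zero fun v _ => ?_
      simp [w, hc, hc.symm]
    · simp
  · intro c hco hca u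
    rw [hG, Finset.sum_eq_single c, Finset.sum_eq_single u]
    · simp [w, hco]
    · intro v _ hv
      simp [w, hco, hv.symm]
    · simp
    · intro c' _ hc'
      refine Finset.sum_eq_zero fun v _ => ?_
      by_cases h1 : c' = o
      · simp [w, h1, hco, hca]
      · simp [w, h1, hc'.symm]
    · simp

open Classical in
/-- A unitary that dilates `L` (if `L` is a contraction), using the flag values `o` and `a`. -/
noncomputable def dilation (L : (ι → ℂ) →ₗ[ℂ] (ι → ℂ)) (o a : F) :
    Matrix.unitaryGroup (ι × F) ℂ :=
  if h : IsContraction L ∧ o ≠ a then (h.1.exists_unitary h.2).choose else 1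

theorem IsContraction.dilation_spec {L : (ι → ℂ) →ₗ[ℂ] (ι → ℂ)} (h : IsContraction L)
    {o a : F} (hoa : o ≠ a) {Φ : ι × F → ℂ} (hΦ : ∀ u, Φ (u, a) = 0) :
    (∀ u, (dilation L o a : Matrix _ _ ℂ).mulVec Φ (u, o) = L (fun v => Φ (v, o)) u) ∧
      ∀ b, b ≠ o → b ≠ a → ∀ u, (dilation L o a : Matrix _ _ ℂ).mulVec Φ (u, b) = Φ (u, b) := by
  rw [dilation, dif_pos ⟨h, hoa⟩]
  exact (h.exists_unitary hoa).choose_spec Φ hΦ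

end Dilation

/-! ## Gates of the reduction -/

section Gates

/-- Substitution along a partial map of the basis. -/
def pullback {ι : Type} (p : ι → Prop) [DecidablePred p] (g : ι → ι) :
    (ι → ℂ) →ₗ[ℂ] (ι → ℂ) where
  toFun φ i := if p i then φ (g i) else 0
  map_add' φ ψ := by
    funext i
    by_cases h : p i <;> simp [h]
  map_smul' a φ := by
    funext i
    by_cases h : p i <;> simp [h]

theorem pullback_apply {ι : Type} (p : ι → Prop) [DecidablePred p] (g : ι → ι) (φ : ι → ℂ)
    (i : ι) : pullback p g φ i = if p i then φ (g i) else 0 := rfl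

/-- Injectivity on `p` ensures that no input amplitude is used twice. -/
theorem IsContraction.pullback {ι : Type} [Fintype ι] [DecidableEq ι] {p : ι → Prop}
    [DecidablePred p] {g : ι → ι} (hg : Set.InjOn g {i | p i}) :
    IsContraction (pullback p g) := by
  intro φ
  have h1 : ∀ i, ‖_root_.pullback p g φ i‖ ^ 2 = if p i then ‖φ (g i)‖ ^ 2 else 0 := fun i => by
    rw [pullback_apply]
    split_ifs <;> simp
  rw [Finset.sum_congr rfl fun i _ => h1 i, ← Finset.sum_filter,
    ← Finset.sum_image (f := fun i => ‖φ i‖ ^ 2) (g := g) fun i hi j hj h =>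
      hg (by simpa using hi) (by simpa using hj) h]
  exact Finset.sum_le_sum_of_subset_of_nonneg (Finset.subset_univ _) fun _ _ _ => by positivity

variable {X C R : Type} [Fintype X] [DecidableEq X] [Fintype C] [DecidableEq C] [AddCommGroup C]
  [Fintype R] [DecidableEq R]

/-- Basis states of the query register, the answer register, the function table and a record. -/
abbrev GateIndex (X C R : Type) : Type := (X × C) × ((X → C) × R)

theorem sum_gateIndex {M : Type*} [AddCommMonoid M] (f : GateIndex X C R → M) :
    ∑ i, f i = ∑ x, ∑ r, ∑ H, ∑ y, f ((x, y), (H, r)) := by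
  simp only [Fintype.sum_prod_type]
  refine Finset.sum_congr rfl fun x _ => ?_
  rw [Finset.sum_comm, Finset.sum_congr rfl fun H _ => Finset.sum_comm]
  exact Finset.sum_comm

/-- Answering a query from the function table. -/
def queryGate : (GateIndex X C R → ℂ) →ₗ[ℂ] (GateIndex X C R → ℂ) :=
  pullback (fun _ => True) fun i => ((i.1.1, i.1.2 - i.2.1 i.1.1), i.2)

/-- Replacing the function table `0` by the uniform superposition of all tables. -/
noncomputable def prepareGate : (GateIndex X C R → ℂ) →ₗ[ℂ] (GateIndex X C R → ℂ) where
  toFun φ i := ((√(Fintype.card (X → C)))⁻¹ : ℝ) * φ (i.1, (fun _ => 0, i.2.2))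
  map_add' _ _ := by
    funext i
    simp [mul_add]
  map_smul' _ _ := by
    funext i
    simp [mul_left_comm]

/-- The commutator of the query and the averaging at the queried point, divided by `√2`. -/
noncomputable def commutatorGate : (GateIndex X C R → ℂ) →ₗ[ℂ] (GateIndex X C R → ℂ) where
  toFun φ i := ((√2)⁻¹ : ℝ) * ((Fintype.card C : ℂ)⁻¹ *
    ∑ c, (φ ((i.1.1, i.1.2 - i.2.1 i.1.1), (Function.update i.2.1 i.1.1 c, i.2.2)) -
      φ ((i.1.1, i.1.2 - c), (Function.update i.2.1 i.1.1 c, i.2.2))))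
  map_add' _ _ := by
    funext i
    simp only [Pi.add_apply, ← mul_add, ← Finset.sum_add_distrib]
    congr! 3
    ring
  map_smul' _ _ := by
    funext i
    simp only [Pi.smul_apply, smul_eq_mul, RingHom.id_apply, ← mul_sub, ← Finset.mul_sum]
    ring

/-- The commutator at the queried point, after which the oracle value at that point is the given
challenge. -/
noncomputable def reprogramGate (θ : C) : (GateIndex X C R → ℂ) →ₗ[ℂ] (GateIndex X C R → ℂ) where
  toFun φ i := if i.2.1 i.1.1 = θ then (√(Fintype.card C) : ℝ) * commutatorGate φ i else 0
  map_add' _ _ := by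
    funext i
    simp only [map_add, Pi.add_apply]
    split_ifs <;> ring
  map_smul' _ _ := by
    funext i
    simp only [map_smul, Pi.smul_apply, smul_eq_mul, RingHom.id_apply]
    split_ifs <;> ring

theorem queryGate_apply (φ : GateIndex X C R → ℂ) (x : X) (y : C) (H : X → C) (r : R) :
    queryGate φ ((x, y), (H, r)) = φ ((x, y - H x), (H, r)) := by
  simp [queryGate, pullback_apply]

theorem prepareGate_apply (φ : GateIndex X C R → ℂ) (p : X × C) (H : X → C) (r : R) :
    prepareGate φ (p, (H, r)) =
      ((√(Fintype.card (X → C)))⁻¹ : ℝ) * φ (p, (fun _ => 0, r)) := rfl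

theorem commutatorGate_apply (φ : GateIndex X C R → ℂ) (x : X) (y : C) (H : X → C) (r : R) :
    commutatorGate φ ((x, y), (H, r)) = ((√2)⁻¹ : ℝ) * ((Fintype.card C : ℂ)⁻¹ *
      ∑ c, (φ ((x, y - H x), (Function.update H x c, r)) -
        φ ((x, y - c), (Function.update H x c, r)))) := rfl

theorem reprogramGate_apply (θ : C) (φ : GateIndex X C R → ℂ) (x : X) (y : C) (H : X → C) (r : R) :
    reprogramGate θ φ ((x, y), (H, r)) = if H x = θ then
      (√(Fintype.card C) : ℝ) * commutatorGate φ ((x, y), (H, r)) else 0 := rfl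

theorem isContraction_queryGate : IsContraction (queryGate (X := X) (C := C) (R := R)) := by
  refine IsContraction.pullback ?_
  rintro ⟨⟨x, y⟩, H, r⟩ - ⟨⟨x', y'⟩, H', r'⟩ - h
  simp only [Prod.mk.injEq] at h
  obtain ⟨⟨rfl, h⟩, rfl, rfl⟩ := h
  rw [sub_left_inj] at h
  rw [h]

theorem isContraction_prepareGate : IsContraction (prepareGate (X := X) (C := C) (R := R)) := by
  intro φ
  have hK : (0 : ℝ) < Fintype.card (X → C) := by
    exact_mod_cast Fintype.card_pos
  rw [sum_gateIndex, sum_gateIndex]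
  refine Finset.sum_le_sum fun x _ => Finset.sum_le_sum fun r _ => ?_
  simp only [prepareGate_apply, norm_mul, mul_pow, Complex.norm_real, norm_inv,
    Real.norm_eq_abs, sq_abs, inv_pow, Real.sq_sqrt hK.le, Finset.sum_const, Finset.card_univ,
    nsmul_eq_mul, ← Finset.mul_sum]
  rw [mul_inv_cancel_left₀ hK.ne']
  exact Finset.single_le_sum (f := fun H => ∑ y, ‖φ ((x, y), (H, r))‖ ^ 2)
    (fun _ _ => by positivity) (Finset.mem_univ _)

/-- The bound holds for each single new entry `θ`, with its share `1 / |C|`, and not only for the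
sum over all entries. Reprogramming to a prescribed challenge rests on this. -/
theorem sum_norm_commutatorGate_sq_le (φ : GateIndex X C R → ℂ) (x : X) (r : R) (H : X → C)
    (θ : C) :
    ∑ y, ‖commutatorGate φ ((x, y), (Function.update H x θ, r))‖ ^ 2 ≤
      (Fintype.card C : ℝ)⁻¹ * ∑ c, ∑ y, ‖φ ((x, y), (Function.update H x c, r))‖ ^ 2 := by
  have hM : (0 : ℝ) < Fintype.card C := by simp [Fintype.card_pos]
  have h := sum_norm_commutator_sq_le (fun c y => φ ((x, y), (Function.update H x c, r))) θ
  have h2 : ‖(((√2)⁻¹ : ℝ) : ℂ)‖ ^ 2 = 2⁻¹ := by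
    rw [Complex.norm_real, Real.norm_eq_abs, sq_abs, inv_pow, Real.sq_sqrt (by norm_num)]
  simp only [commutatorGate_apply, Function.update_self, Function.update_idem, norm_mul, mul_pow,
    h2, norm_inv, Complex.norm_natCast, inv_pow, ← Finset.mul_sum]
  refine (mul_le_mul_of_nonneg_left (mul_le_mul_of_nonneg_left h (by positivity))
    (by norm_num)).trans (le_of_eq ?_)
  field_simp

theorem isContraction_commutatorGate :
    IsContraction (commutatorGate (X := X) (C := C) (R := R)) := by
  intro φ
  have hM : (0 : ℝ) < Fintype.card C := by simp [Fintype.card_pos]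
  rw [sum_gateIndex, sum_gateIndex]
  refine Finset.sum_le_sum fun x _ => Finset.sum_le_sum fun r _ => ?_
  rw [sum_eq_sum_update x, sum_eq_sum_update x fun H => ∑ y, ‖φ ((x, y), (H, r))‖ ^ 2]
  refine mul_le_mul_of_nonneg_left (Finset.sum_le_sum fun H _ => ?_) (by positivity)
  refine (Finset.sum_le_sum fun θ _ => sum_norm_commutatorGate_sq_le φ x r H θ).trans ?_
  rw [Finset.sum_const, Finset.card_univ, nsmul_eq_mul, mul_inv_cancel_left₀ hM.ne']

/-- Only tables with entry `θ` at the queried point survive, and they carry at most the fraction `1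
/ |C|` of the norm squared, which pays for the factor `√|C|`. -/
theorem isContraction_reprogramGate (θ : C) :
    IsContraction (reprogramGate (X := X) (R := R) θ) := by
  intro φ
  have hM : (0 : ℝ) < Fintype.card C := by simp [Fintype.card_pos]
  rw [sum_gateIndex, sum_gateIndex]
  refine Finset.sum_le_sum fun x _ => Finset.sum_le_sum fun r _ => ?_
  rw [sum_eq_sum_update x, sum_eq_sum_update x fun H => ∑ y, ‖φ ((x, y), (H, r))‖ ^ 2]
  refine mul_le_mul_of_nonneg_left (Finset.sum_le_sum fun H _ => ?_) (by positivity)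
  rw [Finset.sum_eq_single θ]
  · simp only [reprogramGate_apply, Function.update_self, if_true, norm_mul, mul_pow,
      Complex.norm_real, Real.norm_eq_abs, sq_abs, Real.sq_sqrt hM.le, ← Finset.mul_sum]
    refine (mul_le_mul_of_nonneg_left (sum_norm_commutatorGate_sq_le φ x r H θ) hM.le).trans ?_
    rw [mul_inv_cancel_left₀ hM.ne']
  · intro c _ hc
    simp [reprogramGate_apply, hc]
  · simp

end Gates

/-! ## How the unitaries of a reduction act -/

section Action

theorem controlled_mulVec {ι o : Type} [Fintype ι] [DecidableEq ι] [Fintype o] [DecidableEq o]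
    (U : o → Matrix.unitaryGroup ι ℂ) (Φ : ι × o → ℂ) (i : ι) (k : o) :
    (controlled U).1.mulVec Φ (i, k) =
      (U k : Matrix ι ι ℂ).mulVec (fun j => Φ (j, k)) i := by
  change ∑ p : ι × o, Matrix.blockDiagonal (fun k => (U k : Matrix ι ι ℂ)) (i, k) p * Φ p =
    ∑ j, (U k : Matrix ι ι ℂ) i j * Φ (j, k)
  rw [Fintype.sum_prod_type]
  refine Finset.sum_congr rfl fun j _ => ?_
  simp [Matrix.blockDiagonal_apply]

theorem relabel_mulVec {ι o : Type} [Fintype ι] [DecidableEq ι] [Fintype o] [DecidableEq o]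
    (e : ι ≃ o) (U : Matrix.unitaryGroup ι ℂ) (Φ : o → ℂ) (k : o) :
    (relabel e U).1.mulVec Φ k =
      (U : Matrix ι ι ℂ).mulVec (fun i => Φ (e i)) (e.symm k) := by
  change ∑ l, (U : Matrix ι ι ℂ) (e.symm k) (e.symm l) * Φ l =
    ∑ i, (U : Matrix ι ι ℂ) (e.symm k) i * Φ (e i)
  rw [← e.sum_comp]
  simp

variable {κ N q : ℕ} {Inst Chal Msg X Mem : Type} {Sig : KeyRing κ Inst → Type}
  [Fintype X] [DecidableEq X] [Fintype Chal] [DecidableEq Chal] [Fintype Mem] [DecidableEq Mem]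
  (A : NRAAdversary N q Msg Sig X Chal)

theorem NRAAdversary.call_mulVec (pk : Fin N → Inst) (k : ℕ) (run : Mem → Bool)
    (Φ : ((X × Chal) × A.Work) × Mem → ℂ) (s : (X × Chal) × A.Work) (μ : Mem) :
    (A.call pk k run).1.mulVec Φ (s, μ) = if run μ then
      (A.step pk k).1.mulVec (fun s' => Φ (s', μ)) s else Φ (s, μ) := by
  rw [NRAAdversary.call, controlled_mulVec]
  split_ifs <;> simp

theorem NRAAdversary.localGate_mulVec (G : Matrix.unitaryGroup ((X × Chal) × Mem) ℂ)
    (Φ : ((X × Chal) × A.Work) × Mem → ℂ) (p : X × Chal) (w : A.Work) (μ : Mem) :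
    (A.localGate G).1.mulVec Φ ((p, w), μ) =
      G.1.mulVec (fun i => Φ ((i.1, w), i.2)) (p, μ) := by
  rw [NRAAdversary.localGate, relabel_mulVec]
  exact controlled_mulVec (fun _ : A.Work => G) _ (p, μ) w

theorem NRAAdversary.readOut_mulVec (G : Forgery Msg Sig → Matrix.unitaryGroup Mem ℂ)
    (Φ : ((X × Chal) × A.Work) × Mem → ℂ) (s : (X × Chal) × A.Work) (μ : Mem) :
    (A.readOut G).1.mulVec Φ (s, μ) =
      (G (A.out s)).1.mulVec (fun μ' => Φ (s, μ')) μ := by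
  rw [NRAAdversary.readOut, relabel_mulVec]
  exact controlled_mulVec (fun a => G (A.out a)) _ μ s

variable {Mem₀ : Type} [Fintype Mem₀] [DecidableEq Mem₀] {f : ℕ}

/-- Contractions on the query register, the answer register and the memory proper, the `k`-th of
them dilated by means of the flag value `o + k + 1`. -/
noncomputable def flaggedGates (L : ℕ → ((X × Chal) × Mem₀ → ℂ) →ₗ[ℂ] ((X × Chal) × Mem₀ → ℂ))
    (o k : ℕ) : Matrix.unitaryGroup ((X × Chal) × (Mem₀ × Fin (f + 1))) ℂ :=
  relabel (Equiv.prodAssoc _ _ _) (dilation (L k) 0 (Fin.ofNat (f + 1) (o + k + 1)))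

/-- A linear map on amplitudes, tensored with the identity on the work register. -/
def liftWork {W : Type} (L : ((X × Chal) × Mem₀ → ℂ) →ₗ[ℂ] ((X × Chal) × Mem₀ → ℂ))
    (φ : ((X × Chal) × W) × Mem₀ → ℂ) : ((X × Chal) × W) × Mem₀ → ℂ :=
  fun i => L (fun j => φ ((j.1, i.1.2), j.2)) (i.1.1, i.2)

/-- The amplitudes, for flag value `0`, after `n` rounds of a pass with dilated contractions. -/
noncomputable def NRAAdversary.flagless (pk : Fin N → Inst) (run : ℕ → Bool)
    (L : ℕ → ((X × Chal) × Mem₀ → ℂ) →ₗ[ℂ] ((X × Chal) × Mem₀ → ℂ))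
    (φ : ((X × Chal) × A.Work) × Mem₀ → ℂ) : ℕ → ((X × Chal) × A.Work) × Mem₀ → ℂ
  | 0 => φ
  | n + 1 => liftWork (L n) fun i => if run n then
      (A.step pk n).1.mulVec (fun s => flagless pk run L φ n (s, i.2)) i.1
      else flagless pk run L φ n i

/-- A pass whose `k`-th gate uses the flag value `o + k + 1`, started in a state without amplitude
on the flag values above `o`. -/
theorem NRAAdversary.pass_mulVec (pk : Fin N → Inst) (run : ℕ → Bool)
    {L : ℕ → ((X × Chal) × Mem₀ → ℂ) →ₗ[ℂ] ((X × Chal) × Mem₀ → ℂ)}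
    (hL : ∀ k, IsContraction (L k)) {o : ℕ} {Φ : ((X × Chal) × A.Work) × (Mem₀ × Fin (f + 1)) → ℂ}
    (hΦ : ∀ s m (b : Fin (f + 1)), o < b.val → Φ (s, (m, b)) = 0) (n : ℕ) (hn : o + n ≤ f) :
    (∀ s m, (A.pass pk (fun k _ => run k) (flaggedGates L o) n).1.mulVec Φ (s, (m, 0)) =
        A.flagless pk run L (fun i => Φ (i.1, (i.2, 0))) n (s, m)) ∧
      ∀ s m (b : Fin (f + 1)), o + n < b.val →
        (A.pass pk (fun k _ => run k) (flaggedGates L o) n).1.mulVec Φ (s, (m, b)) = 0 := by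
  induction n with
  | zero =>
    refine ⟨fun s m => ?_, fun s m b hb => ?_⟩
    · simp [NRAAdversary.pass, NRAAdversary.flagless]
    · simpa [NRAAdversary.pass] using hΦ s m b hb
  | succ n ih =>
    obtain ⟨ih₀, ih₁⟩ := ih (by omega)
    set P := A.pass pk (fun k _ => run k) (flaggedGates (f := f) L o)
    set a := Fin.ofNat (f + 1) (o + n + 1) with ha
    -- The bound `o + n + 1 ≤ f` prevents `Fin.ofNat` from wrapping around, so the flag is new.
    have hav : a.val = o + n + 1 := by
      simp only [ha, Fin.ofNat]
      exact Nat.mod_eq_of_lt (by omega)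
    have ha0 : (0 : Fin (f + 1)) ≠ a := fun h => by
      have := congrArg Fin.val h
      simp [hav] at this
    set Ψ := (A.call pk n (fun _ : Mem₀ × Fin (f + 1) => run n)).1.mulVec
      ((P n).1.mulVec Φ) with hΨ
    have hΨ₁ : ∀ s m (b : Fin (f + 1)), o + n < b.val → Ψ (s, (m, b)) = 0 := fun s m b hb => by
      rw [hΨ, NRAAdversary.call_mulVec]
      split_ifs
      · have : (fun s' => (P n).1.mulVec Φ (s', (m, b))) = 0 :=
          funext fun s' => ih₁ s' m b hb
        rw [this, Matrix.mulVec_zero, Pi.zero_apply]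
      · exact ih₁ s m b hb
    have hstep : (P (n + 1)).1.mulVec Φ =
        (A.localGate (flaggedGates L o n)).1.mulVec Ψ := by
      rw [hΨ, Matrix.mulVec_mulVec, Matrix.mulVec_mulVec]
      rfl
    have hgate : ∀ p w m b, (A.localGate (flaggedGates L o n)).1.mulVec Ψ
        ((p, w), (m, b)) = (dilation (L n) 0 a).1.mulVec
          (fun i => Ψ ((i.1.1, w), (i.1.2, i.2))) ((p, m), b) := fun p w m b => by
      rw [NRAAdversary.localGate_mulVec, flaggedGates, relabel_mulVec]
      rfl
    clear_value a
    -- The dilation may be used because its private flag value has not yet received any amplitude.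
    have hspec := fun w => (hL n).dilation_spec ha0
      (Φ := fun i => Ψ ((i.1.1, w), (i.1.2, i.2))) fun u => hΨ₁ _ _ _ (show o + n < a.val by omega)
    refine ⟨fun ⟨p, w⟩ m => ?_, fun ⟨p, w⟩ m b hb => ?_⟩
    · rw [hstep, hgate, (hspec w).1]
      refine congrFun (congrArg (L n) (funext fun j => ?_)) (p, m)
      change Ψ ((j.1, w), (j.2, 0)) = _
      rw [hΨ, NRAAdversary.call_mulVec]
      simp only [ih₀]
    · rw [hstep, hgate, (hspec w).2 b _ _ _]
      · exact hΨ₁ _ _ _ (show o + n < b.val by omega)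
      · rintro rfl
        simp at hb
      · rintro rfl
        omega

end Action

/-! ## Measuring and reprogramming: the two passes -/

section Passes

/-- For each query an optional record of its input, and an optional commitment. -/
abbrev QueryRecord (q : ℕ) (X Com : Type) : Type := (Fin q → Option X) × Option Com

section RecordGates

variable {X C Com : Type} {q : ℕ} [Fintype X] [DecidableEq X] [Fintype C] [DecidableEq C]
  [Fintype Com] [DecidableEq Com]

/-- Record the queried point as the input of the `k`-th query. -/
def recordGate (k : Fin q) :
    (GateIndex X C (QueryRecord q X Com) → ℂ) →ₗ[ℂ] (GateIndex X C (QueryRecord q X Com) → ℂ) :=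
  pullback (fun i => i.2.2.1 k = some i.1.1)
    fun i => (i.1, (i.2.1, (Function.update i.2.2.1 k none, i.2.2.2)))

theorem recordGate_apply (k : Fin q) (φ : GateIndex X C (QueryRecord q X Com) → ℂ) (x : X) (y : C)
    (H : X → C) (r : Fin q → Option X) (c : Option Com) :
    recordGate k φ ((x, y), (H, (r, c))) =
      if r k = some x then φ ((x, y), (H, (Function.update r k none, c))) else 0 := rfl

theorem isContraction_recordGate (k : Fin q) :
    IsContraction (recordGate (X := X) (C := C) (Com := Com) k) := by
  refine IsContraction.pullback ?_
  rintro ⟨⟨x, y⟩, H, r, c⟩ h ⟨⟨x', y'⟩, H', r', c'⟩ h' hg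
  simp only [Set.mem_ofPred_eq, Prod.mk.injEq] at h h' hg
  obtain ⟨⟨rfl, rfl⟩, rfl, hr, rfl⟩ := hg
  have : r = r' := by
    funext i
    by_cases hi : i = k
    · rw [hi, h, h']
    · simpa [hi] using congrFun hr i
  rw [this]

/-- Write a commitment that depends on the recorded queries. -/
def writeGate (g : (Fin q → Option X) → Com) :
    ((X → C) × QueryRecord q X Com → ℂ) →ₗ[ℂ] ((X → C) × QueryRecord q X Com → ℂ) :=
  pullback (fun m => m.2.2 = some (g m.2.1)) fun m => (m.1, (m.2.1, none))

theorem writeGate_apply (g : (Fin q → Option X) → Com)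
    (φ : (X → C) × QueryRecord q X Com → ℂ) (H : X → C) (r : Fin q → Option X)
    (c : Option Com) :
    writeGate g φ (H, (r, c)) = if c = some (g r) then φ (H, (r, none)) else 0 := rfl

theorem isContraction_writeGate (g : (Fin q → Option X) → Com) :
    IsContraction (writeGate (C := C) g) := by
  refine IsContraction.pullback ?_
  rintro ⟨H, r, c⟩ h ⟨H', r', c'⟩ h' hg
  simp only [Set.mem_ofPred_eq, Prod.mk.injEq] at h h' hg
  obtain ⟨rfl, rfl, -⟩ := hg
  rw [h, h']

end RecordGates

variable {X Chal Com : Type} [Fintype X] [DecidableEq X] [Fintype Chal] [DecidableEq Chal]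
  [AddCommGroup Chal] [Fintype Com] [DecidableEq Com] {q : ℕ}

open Classical in
/-- The gates before the commitment is sent: up to time `T` (exclusively) the queries at the times
in `ext` are measured and replaced by commutators, the others are answered.  The query at time `T`
is only measured. -/
noncomputable def extractGates (ext : ℕ → Prop) (T k : ℕ) :
    (GateIndex X Chal (QueryRecord q X Com) → ℂ) →ₗ[ℂ]
      (GateIndex X Chal (QueryRecord q X Com) → ℂ) :=
  (if h : k < q then
    if k < T then if ext k then commutatorGate ∘ₗ recordGate ⟨k, h⟩ else queryGate
    else if k = T then recordGate ⟨k, h⟩ else LinearMap.id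
  else LinearMap.id) ∘ₗ (if k = 0 then prepareGate else LinearMap.id)

/-- The gates after the challenge was received: the query at time `T` is reprogrammed to the
challenge, later queries are answered. -/
noncomputable def reprogramGates {R : Type} (q T : ℕ) (θ : Chal) (k : ℕ) :
    (GateIndex X Chal R → ℂ) →ₗ[ℂ] (GateIndex X Chal R → ℂ) :=
  if k < q then if k < T then LinearMap.id else if k = T then reprogramGate θ else queryGate
  else LinearMap.id

theorem isContraction_extractGates (ext : ℕ → Prop) (T k : ℕ) :
    IsContraction (extractGates (X := X) (Chal := Chal) (Com := Com) (q := q) ext T k) := by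
  rw [extractGates]
  refine IsContraction.comp ?_ ?_
  · split_ifs
    · exact isContraction_commutatorGate.comp (isContraction_recordGate _)
    · exact isContraction_queryGate
    · exact isContraction_recordGate _
    · exact IsContraction.id
    · exact IsContraction.id
  · split_ifs
    · exact isContraction_prepareGate
    · exact IsContraction.id

theorem isContraction_reprogramGates {R : Type} [Fintype R] [DecidableEq R] (T : ℕ) (θ : Chal)
    (k : ℕ) : IsContraction (reprogramGates (X := X) (R := R) q T θ k) := by
  rw [reprogramGates]
  split_ifs
  · exact IsContraction.id
  · exact isContraction_reprogramGate θ
  · exact isContraction_queryGate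
  · exact IsContraction.id

/-- The records after the first `n` queries of a run with the given schedule. -/
def recordAt (τ : ℕ → Option X) (n : ℕ) (i : Fin q) : Option X := if (i : ℕ) < n then τ i else none

theorem update_recordAt (τ : ℕ → Option X) (k : Fin q) :
    Function.update (recordAt τ (k + 1)) k none = recordAt τ (k : ℕ) := by
  funext i
  by_cases hi : i = k
  · subst hi
    simp [recordAt]
  · have hne : (i : ℕ) ≠ k := fun h => hi (Fin.ext h)
    have : (i : ℕ) < k + 1 ↔ (i : ℕ) < k := ⟨by omega, by omega⟩
    rw [Function.update_of_ne hi, recordAt, recordAt]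
    simp only [this]

theorem recordAt_succ_self (τ : ℕ → Option X) (k : Fin q) : recordAt τ (k + 1) k = τ k := by
  simp [recordAt]

theorem recordAt_succ_of_eq_none {τ : ℕ → Option X} {k : ℕ} (h : τ k = none) :
    (recordAt τ (k + 1) : Fin q → Option X) = recordAt τ k := by
  funext i
  rw [recordAt, recordAt]
  by_cases hi : (i : ℕ) = k
  · simp [hi, h]
  · have : (i : ℕ) < k + 1 ↔ (i : ℕ) < k := ⟨by omega, by omega⟩
    simp only [this]

/-- The factor by which the amplitudes of a scheduled run are scaled down. -/
noncomputable def scheduleFactor (τ : ℕ → Option X) (n : ℕ) : ℝ :=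
  ∏ i ∈ Finset.range n, if τ i = none then 1 else (√2)⁻¹

variable {κ N : ℕ} {Inst Msg : Type} {Sig : KeyRing κ Inst → Type}
  (A : NRAAdversary N q Msg Sig X Chal) (pk : Fin N → Inst)

/-- The amplitudes just before the `n`-th gate of the first pass, after the preparation. -/
noncomputable def NRAAdversary.beforeGate {R : Type}
    (ψ : ℕ → ((X × Chal) × A.Work) × ((X → Chal) × R) → ℂ) (n : ℕ) : ((X × Chal) × A.Work) × ((X → Chal) × R) → ℂ :=
  liftWork (if n = 0 then prepareGate else LinearMap.id) fun i =>
    (A.step pk n).1.mulVec (fun s => ψ n (s, i.2)) i.1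

/-- The initial amplitudes of the first pass. -/
noncomputable def NRAAdversary.initial (A : NRAAdversary N q Msg Sig X Chal) (Com : Type)
    [DecidableEq Com] : ((X × Chal) × A.Work) × ((X → Chal) × QueryRecord q X Com) → ℂ :=
  fun i => if i.2 = (fun _ => 0, (fun _ => none, none)) then
    (Pi.single A.start 1 : (X × Chal) × A.Work → ℂ) i.1 else 0

/-- The amplitudes during the first pass. -/
noncomputable def NRAAdversary.extractPass (Com : Type) [Fintype Com] [DecidableEq Com]
    (ext : ℕ → Prop) (T : ℕ) :
    ℕ → ((X × Chal) × A.Work) × ((X → Chal) × QueryRecord q X Com) → ℂ :=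
  A.flagless pk (fun k => decide (k ≤ T)) (extractGates ext T) (A.initial Com)

/-- A scheduled run of the forger. -/
noncomputable abbrev NRAAdversary.scheduled (τ : ℕ → Option X) (n : ℕ) :
    PurifiedAmp X Chal A.Work :=
  scheduledRun (fun k => (A.step pk k).1) (Pi.single A.start 1) τ n

-- On the branch whose records match the schedule, every measured query keeps just the amplitude
-- with the scheduled input, which is where the commutator at that point is supported. The first
-- pass thus reproduces the scheduled run, up to the normalisation of the uniform table and `1 / √2`
-- per commutator.
open Classical in
theorem NRAAdversary.beforeGate_extractPass {ext : ℕ → Prop} {τ : ℕ → Option X}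
    (hτ : ∀ k, ext k ↔ τ k ≠ none) {T : ℕ} (hT : T ≤ q) {n : ℕ} (hn : n ≤ T) (H : X → Chal)
    (s : (X × Chal) × A.Work) :
    A.beforeGate pk (A.extractPass pk Com ext T) n (s, (H, (recordAt τ n, none))) =
      (((√(Fintype.card (X → Chal)))⁻¹ * scheduleFactor τ n : ℝ) : ℂ) *
        applyMatrix (A.step pk n).1 (A.scheduled pk τ n) H s := by
  induction n generalizing H s with
  | zero =>
    have h0 : (recordAt τ 0 : Fin q → Option X) = fun _ => none := by
      funext i
      simp [recordAt]
    rw [NRAAdversary.beforeGate, if_pos rfl, liftWork, prepareGate_apply, h0]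
    simp only [scheduleFactor, Finset.range_zero, Finset.prod_empty, mul_one]
    congr 2
    funext s'
    simp [NRAAdversary.extractPass, NRAAdversary.flagless, NRAAdversary.initial]
    rfl
  | succ n ih =>
    have hstate : ∀ s, A.extractPass pk Com ext T (n + 1) (s, (H, (recordAt τ (n + 1), none))) =
        (((√(Fintype.card (X → Chal)))⁻¹ * scheduleFactor τ (n + 1) : ℝ) : ℂ) *
          A.scheduled pk τ (n + 1) H s := by
      rintro ⟨⟨x, y⟩, w⟩
      have hnq : n < q := by omega
      have hT' : n < T := by omega
      have hunfold : A.extractPass pk Com ext T (n + 1) =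
          liftWork (if ext n then commutatorGate ∘ₗ recordGate ⟨n, hnq⟩ else queryGate)
            (A.beforeGate pk (A.extractPass pk Com ext T) n) := by
        rw [NRAAdversary.extractPass, NRAAdversary.flagless, extractGates, dif_pos hnq, if_pos hT',
          NRAAdversary.beforeGate]
        simp only [decide_eq_true hT'.le, if_true]
        rfl
      rw [hunfold, liftWork, NRAAdversary.scheduled, scheduledRun, scheduleFactor,
        Finset.prod_range_succ, ← scheduleFactor]
      cases hk : τ n with
      | none =>
        have hext : ¬ ext n := by simp [hτ, hk]
        rw [if_neg hext, queryGate_apply, recordAt_succ_of_eq_none hk, ih (by omega)]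
        simp only [if_true, mul_one]
        rfl
      | some x₀ =>
        have hext : ext n := by simp [hτ, hk]
        rw [if_pos hext, LinearMap.comp_apply, commutatorGate_apply]
        simp only [recordGate_apply, recordAt_succ_self τ ⟨n, hnq⟩, update_recordAt τ ⟨n, hnq⟩, hk,
          Option.some.injEq]
        rw [scheduledQuery, queryCommutator_apply]
        by_cases hx : x₀ = x
        · subst hx
          simp only [if_true, ih (by omega), ← mul_sub, ← Finset.mul_sum]
          push_cast
          simp
          ring
        · simp [hx, Ne.symm hx]
    rw [NRAAdversary.beforeGate, if_neg n.succ_ne_zero, liftWork, LinearMap.id_apply]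
    simp only [hstate]
    exact congrFun (Matrix.mulVec_smul (A.step pk (n + 1)).1
      (((√(Fintype.card (X → Chal)))⁻¹ * scheduleFactor τ (n + 1) : ℝ) : ℂ)
      (A.scheduled pk τ (n + 1) H)) s

/-- With `T = q` the complete run takes place in the first pass. -/
theorem NRAAdversary.extractPass_last {ext : ℕ → Prop} {τ : ℕ → Option X}
    (hτ : ∀ k, ext k ↔ τ k ≠ none) (H : X → Chal) (s : (X × Chal) × A.Work) :
    A.extractPass pk Com ext q (q + 1) (s, (H, (recordAt τ q, none))) =
      (((√(Fintype.card (X → Chal)))⁻¹ * scheduleFactor τ q : ℝ) : ℂ) *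
        applyMatrix (A.step pk q).1 (A.scheduled pk τ q) H s := by
  rw [← A.beforeGate_extractPass (Com := Com) pk hτ le_rfl le_rfl, NRAAdversary.extractPass,
    NRAAdversary.flagless, extractGates, dif_neg (lt_irrefl q), NRAAdversary.beforeGate]
  simp only [decide_eq_true le_rfl, if_true]
  rfl

theorem NRAAdversary.scheduled_succ (τ : ℕ → Option X) (n : ℕ) :
    A.scheduled pk τ (n + 1) =
      scheduledQuery (τ n) (applyMatrix (A.step pk n).1 (A.scheduled pk τ n)) := rfl

/-- After time `T` the forger is no longer called and the gates are trivial: the first pass freezes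
the run until the challenge arrives. -/
theorem NRAAdversary.extractPass_of_lt (ext : ℕ → Prop) {T n : ℕ} (hn : T < n) :
    A.extractPass pk Com ext T n = A.extractPass pk Com ext T (T + 1) := by
  induction n, hn using Nat.le_induction with
  | base => rfl
  | succ n hn ih =>
    have h0 : n ≠ 0 := by omega
    have h1 : ¬ n < T := by omega
    have h2 : n ≠ T := by omega
    have h3 : ¬ n ≤ T := by omega
    rw [← ih, NRAAdversary.extractPass, NRAAdversary.flagless, extractGates, if_neg h0]
    simp only [h1, h2, h3, decide_false, Bool.false_eq_true, if_false, dite_eq_ite, ite_self]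
    rfl

/-- The query at time `T` is recorded but not yet answered, so the factor still stops at `T`; the
missing `1 / √2` comes with the reprogramming. -/
theorem NRAAdversary.extractPass_measured {ext : ℕ → Prop} {τ : ℕ → Option X}
    (hτ : ∀ k, ext k ↔ τ k ≠ none) {T : ℕ} (hT : T < q) {x : X} (hx : τ T = some x) (H : X → Chal)
    (s : (X × Chal) × A.Work) :
    A.extractPass pk Com ext T (q + 1) (s, (H, (recordAt τ (T + 1), none))) =
      if s.1.1 = x then (((√(Fintype.card (X → Chal)))⁻¹ * scheduleFactor τ T : ℝ) : ℂ) *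
        applyMatrix (A.step pk T).1 (A.scheduled pk τ T) H s else 0 := by
  have hunfold : A.extractPass pk Com ext T (T + 1) =
      liftWork (recordGate ⟨T, hT⟩) (A.beforeGate pk (A.extractPass pk Com ext T) T) := by
    rw [NRAAdversary.extractPass, NRAAdversary.flagless, extractGates, dif_pos hT,
      if_neg (lt_irrefl T), if_pos rfl, NRAAdversary.beforeGate]
    simp only [decide_eq_true le_rfl, if_true]
    rfl
  obtain ⟨⟨y, c⟩, w⟩ := s
  rw [A.extractPass_of_lt pk ext (show T < q + 1 by omega), hunfold, liftWork, recordGate_apply,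
    recordAt_succ_self τ ⟨T, hT⟩, update_recordAt τ ⟨T, hT⟩, hx,
    ← A.beforeGate_extractPass (Com := Com) pk hτ hT.le le_rfl]
  simp only [Option.some.injEq, eq_comm]

/-- The amplitudes during the second pass. -/
noncomputable def NRAAdversary.reprogramPass {R : Type} (T : ℕ) (θ : Chal) :
    (((X × Chal) × A.Work) × ((X → Chal) × R) → ℂ) →
      ℕ → ((X × Chal) × A.Work) × ((X → Chal) × R) → ℂ :=
  A.flagless pk (fun k => decide (T < k)) (reprogramGates q T θ)

theorem NRAAdversary.reprogramPass_of_le {R : Type} {T : ℕ} (θ : Chal)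
    (φ : ((X × Chal) × A.Work) × ((X → Chal) × R) → ℂ) {n : ℕ} (hn : n ≤ T) :
    A.reprogramPass pk T θ φ n = φ := by
  induction n with
  | zero => rfl
  | succ n ih =>
    have h1 : n < T := hn
    have h2 : ¬ T < n := by omega
    rw [NRAAdversary.reprogramPass, NRAAdversary.flagless, reprogramGates]
    simp only [h1, h2, if_true, ite_self, decide_false, Bool.false_eq_true, if_false]
    exact ih h1.le

theorem NRAAdversary.reprogramPass_last {R : Type} (θ : Chal)
    (φ : ((X × Chal) × A.Work) × ((X → Chal) × R) → ℂ) :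
    A.reprogramPass pk q θ φ (q + 1) = φ := by
  rw [NRAAdversary.reprogramPass, NRAAdversary.flagless, reprogramGates, if_neg (lt_irrefl q)]
  simp only [lt_irrefl, decide_false, Bool.false_eq_true, if_false]
  exact A.reprogramPass_of_le pk θ φ le_rfl

/-- The second pass resumes the frozen run at time `T` with the commutator restricted to the entry
`θ`, and answers all later queries from the table. -/
theorem NRAAdversary.reprogramPass_apply {R : Type} [Fintype R] [DecidableEq R] {τ : ℕ → Option X}
    {T : ℕ} (hT : T < q) {x : X} (hx : τ T = some x) (hτ : ∀ k, T < k → τ k = none) (θ : Chal)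
    {φ : ((X × Chal) × A.Work) × ((X → Chal) × R) → ℂ} {r : R} {a : ℂ}
    (hφ : ∀ H s, φ (s, (H, r)) = if s.1.1 = x then
      a * applyMatrix (A.step pk T).1 (A.scheduled pk τ T) H s else 0) (H : X → Chal)
    (s : (X × Chal) × A.Work) :
    A.reprogramPass pk T θ φ (q + 1) (s, (H, r)) =
      if H x = θ then ((√(Fintype.card Chal) * (√2)⁻¹ : ℝ) : ℂ) * a *
        applyMatrix (A.step pk q).1 (A.scheduled pk τ q) H s else 0 := by
  -- This factor depends on the table only, which the later queries do not change, so it passes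
  -- through the rest of the run.
  set b : ℂ := if H x = θ then ((√(Fintype.card Chal) * (√2)⁻¹ : ℝ) : ℂ) * a else 0 with hb
  have hstep : ∀ n, T < n → n ≤ q → ∀ s, A.reprogramPass pk T θ φ n (s, (H, r)) =
      b * A.scheduled pk τ n H s := by
    intro n hn
    induction n, hn using Nat.le_induction with
    | base =>
      rintro - ⟨⟨y, c⟩, w⟩
      rw [NRAAdversary.reprogramPass, NRAAdversary.flagless, reprogramGates, if_pos hT,
        if_neg (lt_irrefl T), if_pos rfl]
      simp only [lt_irrefl, decide_false, Bool.false_eq_true, if_false]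
      rw [← NRAAdversary.reprogramPass, A.reprogramPass_of_le pk θ φ le_rfl, liftWork,
        reprogramGate_apply, commutatorGate_apply]
      simp only [hφ]
      rw [A.scheduled_succ, hx, scheduledQuery, queryCommutator_apply]
      by_cases hy : y = x
      · subst hy
        by_cases hH : H y = θ
        · simp only [hb, hH, if_true, ← mul_sub, ← Finset.mul_sum]
          push_cast
          ring
        · simp [hb, hH]
      · simp [hy]
    | succ n hn ih =>
      rintro hnq ⟨⟨y, c⟩, w⟩
      have h1 : n < q := by omega
      have h2 : ¬ n < T := by omega
      have h3 : n ≠ T := by omega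
      have h4 : T < n := hn
      rw [NRAAdversary.reprogramPass, NRAAdversary.flagless, reprogramGates, if_pos h1, if_neg h2,
        if_neg h3]
      simp only [h4, decide_true, if_true]
      rw [← NRAAdversary.reprogramPass, liftWork, queryGate_apply]
      simp only [ih h1.le]
      rw [A.scheduled_succ, hτ n h4, scheduledQuery, purifiedQuery_apply]
      exact congrFun (Matrix.mulVec_smul (A.step pk n).1 b (A.scheduled pk τ n H)) _
  rw [NRAAdversary.reprogramPass, NRAAdversary.flagless, reprogramGates, if_neg (lt_irrefl q)]
  simp only [hT, decide_true, if_true]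
  rw [← NRAAdversary.reprogramPass, liftWork, LinearMap.id_apply]
  simp only [hstep q hT le_rfl]
  refine (congrFun (Matrix.mulVec_smul (A.step pk q).1 b (A.scheduled pk τ q H)) _).trans ?_
  rw [Pi.smul_apply, smul_eq_mul, hb, ite_mul, zero_mul]
  rfl

end Passes

/-! ## Measure-and-reprogram reductions -/

section MeasureAndReprogram

variable {κ N q : ℕ} {Inst Com Chal Rsp Msg X : Type} {Sig : KeyRing κ Inst → Type}
  [Fintype X] [DecidableEq X] [Fintype Com] [DecidableEq Com] [Nonempty Com]
  [Fintype Chal] [DecidableEq Chal] [AddCommGroup Chal]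

/-- A reduction that simulates the random oracle by a function table in superposition, measures the
queries at the times in `ext`, sends a commitment computed from the measured queries and the
forger's output, and reprograms the oracle to the challenge at the point queried at time `last`. -/
noncomputable def measureReduction {Coin : Type} [Fintype Coin] (coin : PMF Coin)
    (keys : View N Inst Coin → Fin N → Inst) (ext : View N Inst Coin → ℕ → Prop)
    (last : View N Inst Coin → ℕ)
    (commitment : View N Inst Coin → Forgery Msg Sig → (Fin q → Option X) → Com)
    (rsp : View N Inst Coin → Forgery Msg Sig → Rsp) :
    BlackBoxReduction N q Inst Com Chal Rsp Msg Sig X where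
  Coin := Coin
  coin := coin
  -- Flag values: `0` for the branch of interest, `1` to `q + 1` for the first pass, `q + 2` for
  -- writing the commitment, `q + 3` to `2q + 3` for the second pass.
  Mem := ((X → Chal) × QueryRecord q X Com) × Fin (2 * q + 3 + 1)
  start := ((fun _ => 0, (fun _ => none, none)), 0)
  keys := keys
  run₁ v k _ := decide (k ≤ last v)
  gate₁ v := flaggedGates (extractGates (ext v) (last v)) 0
  read₁ v f := dilation (writeGate (commitment v f)) 0 (Fin.ofNat _ (q + 2))
  -- The default is sent only where no commitment was written; such branches are not counted in the
  -- lower bounds.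
  com m := m.1.2.2.getD (Classical.arbitrary Com)
  run₂ v _ k _ := decide (last v < k)
  gate₂ v ch := flaggedGates (reprogramGates q (last v) ch) (q + 2)
  rsp v _ f _ := rsp v f

variable (A : NRAAdversary N q Msg Sig X Chal) (pk : Fin N → Inst)

/-- The amplitudes after the first pass, when the commitment has been written. -/
noncomputable def NRAAdversary.writtenPass (ext : ℕ → Prop) (T : ℕ)
    (commitment : Forgery Msg Sig → (Fin q → Option X) → Com)
    (i : ((X × Chal) × A.Work) × ((X → Chal) × QueryRecord q X Com)) : ℂ :=
  writeGate (commitment (A.out i.1))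
    (fun m => A.extractPass pk Com ext T (q + 1) (i.1, m)) i.2

/-- The amplitudes after the measurement of the commitment. -/
noncomputable def NRAAdversary.committedPass (ext : ℕ → Prop) (T : ℕ)
    (commitment : Forgery Msg Sig → (Fin q → Option X) → Com) (c : Com)
    (i : ((X × Chal) × A.Work) × ((X → Chal) × QueryRecord q X Com)) : ℂ :=
  if i.2.2.2.getD (Classical.arbitrary Com) = c then A.writtenPass pk ext T commitment i else 0

theorem NRAAdversary.writtenPass_mulVec (ext : ℕ → Prop) (T : ℕ)
    (commitment : Forgery Msg Sig → (Fin q → Option X) → Com)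
    (Φ : ((X × Chal) × A.Work) × (((X → Chal) × QueryRecord q X Com) × Fin (2 * q + 3 + 1)) → ℂ)
    (hΦ : ∀ i, Φ i = if i.2 = ((fun _ => 0, (fun _ => none, none)), 0) then
      (Pi.single A.start 1 : (X × Chal) × A.Work → ℂ) i.1 else 0) :
    let Ψ := (A.readOut fun f => dilation (writeGate (commitment f)) 0
      (Fin.ofNat (2 * q + 3 + 1) (q + 2))).1.mulVec
        ((A.pass pk (fun k _ => decide (k ≤ T)) (flaggedGates (extractGates ext T) 0)
          (q + 1)).1.mulVec Φ)
    (∀ s m, Ψ (s, (m, 0)) = A.writtenPass pk ext T commitment (s, m)) ∧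
      ∀ s m (b : Fin (2 * q + 3 + 1)), q + 2 < b.val → Ψ (s, (m, b)) = 0 := by
  intro Ψ
  set a := Fin.ofNat (2 * q + 3 + 1) (q + 2) with ha
  have hav : a.val = q + 2 := by
    simp only [ha, Fin.ofNat]
    exact Nat.mod_eq_of_lt (by omega)
  have ha0 : (0 : Fin (2 * q + 3 + 1)) ≠ a := fun h => by
    have := congrArg Fin.val h
    simp [hav] at this
  obtain ⟨h₀, h₁⟩ := A.pass_mulVec (o := 0) (f := 2 * q + 3) (Φ := Φ) pk
    (fun k => decide (k ≤ T)) (isContraction_extractGates (Com := Com) (q := q) ext T)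
    (fun s m b hb => by
      rw [hΦ, if_neg]
      intro h
      have := congrArg (fun x => x.2.val) h
      simp only [Fin.val_zero] at this
      omega) (q + 1) (by omega)
  have hread : ∀ s m b, Ψ (s, (m, b)) = _ := fun s m b => A.readOut_mulVec _ _ s (m, b)
  have hspec := fun s => (isContraction_writeGate (C := Chal) (commitment (A.out s))).dilation_spec
    ha0 (Φ := fun μ => (A.pass pk (fun k _ => decide (k ≤ T))
      (flaggedGates (extractGates ext T) 0) (q + 1)).1.mulVec Φ (s, μ))
    fun m => h₁ s m a (by omega)
  refine ⟨fun s m => ?_, fun s m b hb => ?_⟩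
  · rw [hread, (hspec s).1, NRAAdversary.writtenPass]
    simp only [h₀]
    have hinit : (fun i => Φ (i.1, (i.2, 0))) = A.initial Com := by
      funext i
      rw [hΦ, NRAAdversary.initial]
      simp
    rw [hinit]
    rfl
  · rw [hread, (hspec s).2 b _ _ m]
    · exact h₁ s m b (by omega)
    · rintro rfl
      simp at hb
    · rintro rfl
      omega

theorem NRAAdversary.reprogramPass_mulVec (T : ℕ) (θ : Chal)
    (Φ : ((X × Chal) × A.Work) × (((X → Chal) × QueryRecord q X Com) × Fin (2 * q + 3 + 1)) → ℂ)
    (hΦ : ∀ s m (b : Fin (2 * q + 3 + 1)), q + 2 < b.val → Φ (s, (m, b)) = 0)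
    (s : (X × Chal) × A.Work) (m : (X → Chal) × QueryRecord q X Com) :
    (A.pass pk (fun k _ => decide (T < k)) (flaggedGates (reprogramGates q T θ) (q + 2))
      (q + 1)).1.mulVec Φ (s, (m, 0)) =
      A.reprogramPass pk T θ (fun i => Φ (i.1, (i.2, 0))) (q + 1) (s, m) :=
  (A.pass_mulVec (o := q + 2) (f := 2 * q + 3) (Φ := Φ) pk (fun k => decide (T < k))
    (isContraction_reprogramGates (R := QueryRecord q X Com) (q := q) T θ) hΦ (q + 1)
      (by omega)).1 s m

variable [Fintype Inst] {Wit St : Type}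

/-- The success probability of an impersonation adversary with fixed coins on a fixed instance. -/
noncomputable def ImpAdversary.successAt (S : SigmaProtocol Inst Wit St Com Chal Rsp)
    (B : ImpAdversary Inst Com Chal Rsp) (ω : B.Coin) (x : Inst) : ℝ :=
  ∑ c : Com, ((Fintype.card Chal : ℝ)⁻¹ * ∑ ch : Chal, ∑ s : B.Space,
    if S.verify x c ch (B.rsp ω x ch s) = true then
      ‖Matrix.mulVec (B.respond ω x ch : Matrix _ _ ℂ) (B.committed ω x c) s‖ ^ 2 else 0)

theorem single_prod_eq {α β : Type} [DecidableEq α] [DecidableEq β] [DecidableEq (α × β)]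
    (a : α) (b : β) : (Pi.single (a, b) 1 : α × β → ℂ) =
      fun i => if i.2 = b then (Pi.single a 1 : α → ℂ) i.1 else 0 := by
  funext i
  obtain ⟨i, j⟩ := i
  by_cases h₁ : i = a <;> by_cases h₂ : j = b <;> simp [h₁, h₂]

variable {Coin : Type} [Fintype Coin] (coin : PMF Coin)
  (keys : View N Inst Coin → Fin N → Inst) (ext : View N Inst Coin → ℕ → Prop)
  (last : View N Inst Coin → ℕ)
  (commitment : View N Inst Coin → Forgery Msg Sig → (Fin q → Option X) → Com)
  (rsp : View N Inst Coin → Forgery Msg Sig → Rsp) (D : PMF Inst) (ω : Coin) (x : Inst)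
  (u : Fin N → Inst)

set_option synthInstance.maxSize 1000 in
theorem committed_measureReduction (c : Com) :
    ((measureReduction coin keys ext last commitment rsp).toImpAdversary D A).committed (ω, u) x c =
      fun i : ((X × Chal) × A.Work) × (((X → Chal) × QueryRecord q X Com) × Fin (2 * q + 3 + 1)) =>
      if i.2.1.2.2.getD (Classical.arbitrary Com) = c then
        (A.readOut fun f => dilation (writeGate (commitment (ω, x, u) f)) 0
          (Fin.ofNat (2 * q + 3 + 1) (q + 2))).1.mulVec
            ((A.pass (keys (ω, x, u)) (fun k _ => decide (k ≤ last (ω, x, u)))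
              (flaggedGates (extractGates (ext (ω, x, u)) (last (ω, x, u))) 0) (q + 1)).1.mulVec
                fun i => if i.2 = ((fun _ => 0, (fun _ => none, none)), 0) then
                  (Pi.single A.start 1 : (X × Chal) × A.Work → ℂ) i.1 else 0) i else 0 := by
  funext i
  by_cases h : i.2.1.2.2.getD (Classical.arbitrary Com) = c
  · refine (if_pos h).trans (Eq.trans ?_ (if_pos h).symm)
    rw [← single_prod_eq, Matrix.mulVec_mulVec]
    rfl
  · exact (if_neg h).trans (if_neg h).symm

/-- Amplitude on flag value `0` comes only from flag value `0`, through both passes and the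
measurement of the commitment, so it can be computed with the contractions alone. -/
theorem respond_measureReduction (c : Com) (ch : Chal) (s : (X × Chal) × A.Work)
    (m : (X → Chal) × QueryRecord q X Com) :
    let B := (measureReduction coin keys ext last commitment rsp).toImpAdversary D A
    (B.respond (ω, u) x ch).1.mulVec (B.committed (ω, u) x c) (s, (m, 0)) =
      A.reprogramPass (keys (ω, x, u)) (last (ω, x, u)) ch
        (A.committedPass (keys (ω, x, u)) (ext (ω, x, u)) (last (ω, x, u))
          (commitment (ω, x, u)) c) (q + 1) (s, m) := by
  intro B
  obtain ⟨h₀, h₁⟩ := A.writtenPass_mulVec (keys (ω, x, u)) (ext (ω, x, u)) (last (ω, x, u))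
    (commitment (ω, x, u)) _ fun i => rfl
  refine (congrFun (congrArg (B.respond (ω, u) x ch).1.mulVec
    (committed_measureReduction A coin keys ext last commitment rsp D ω x u c)) _).trans ?_
  refine (A.reprogramPass_mulVec (keys (ω, x, u)) (last (ω, x, u)) ch _ ?_ s m).trans ?_
  · intro s m b hb
    simp only [h₁ s m b hb, ite_self]
  · simp only [h₀]
    rfl

/-- The success probability is at least the probability of ending in a state whose memory is
prescribed up to the function table. -/
theorem le_successAt_measureReduction (S : SigmaProtocol Inst Wit St Com Chal Rsp)
    (r : (X × Chal) × A.Work → Fin q → Option X) (c : (X × Chal) × A.Work → Com) :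
    (Fintype.card Chal : ℝ)⁻¹ * ∑ ch : Chal, ∑ s : (X × Chal) × A.Work, ∑ H : X → Chal,
      (if S.verify x (c s) ch (rsp (ω, x, u) (A.out s)) = true then
        ‖A.reprogramPass (keys (ω, x, u)) (last (ω, x, u)) ch
          (A.committedPass (keys (ω, x, u)) (ext (ω, x, u)) (last (ω, x, u))
            (commitment (ω, x, u)) (c s)) (q + 1) (s, (H, (r s, some (c s))))‖ ^ 2 else 0) ≤
    ((measureReduction coin keys ext last commitment rsp).toImpAdversary D A).successAt S
      (ω, u) x := by
  let B := (measureReduction coin keys ext last commitment rsp).toImpAdversary D A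
  let F : Chal → Com → ((X × Chal) × A.Work) ×
      (((X → Chal) × QueryRecord q X Com) × Fin (2 * q + 3 + 1)) → ℝ := fun ch c i =>
    if S.verify x c ch (rsp (ω, x, u) (A.out i.1)) = true then
      ‖(B.respond (ω, u) x ch).1.mulVec (B.committed (ω, u) x c) i‖ ^ 2 else 0
  have hF : ∀ ch c i, 0 ≤ F ch c i := fun ch c i => by
    simp only [F]
    split_ifs <;> positivity
  change _ ≤ ∑ c, ((Fintype.card Chal : ℝ)⁻¹ * ∑ ch, ∑ i, F ch c i)
  rw [← Finset.mul_sum, Finset.sum_comm (s := (Finset.univ : Finset Com))]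
  refine mul_le_mul_of_nonneg_left (Finset.sum_le_sum fun ch _ => ?_) (by positivity)
  simp only [← respond_measureReduction A coin keys ext last commitment rsp D ω x u]
  change ∑ s, ∑ H, F ch (c s) (s, ((H, (r s, some (c s))), 0)) ≤ ∑ c, ∑ i, F ch c i
  rw [Finset.sum_comm (s := (Finset.univ : Finset Com))]
  rw [Fintype.sum_prod_type fun i => ∑ c, F ch c i]
  refine Finset.sum_le_sum fun s _ => ?_
  rw [Finset.sum_comm]
  -- For each final register state only the commitment `c s` is kept; the other terms are
  -- nonnegative.
  refine le_trans ?_ (Finset.single_le_sum (f := fun c => ∑ m, F ch c (s, m))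
    (fun c _ => Finset.sum_nonneg fun _ _ => hF _ _ _) (Finset.mem_univ (c s)))
  have hinj : Function.Injective fun H : X → Chal =>
      (((H, (r s, some (c s))), 0) :
        ((X → Chal) × QueryRecord q X Com) × Fin (2 * q + 3 + 1)) := by
    intro H H' h
    simpa using h
  rw [← Finset.sum_image (f := fun m => F ch (c s) (s, m)) (g := fun H : X → Chal =>
      (((H, (r s, some (c s))), 0) :
        ((X → Chal) × QueryRecord q X Com) × Fin (2 * q + 3 + 1))) hinj.injOn]
  exact Finset.sum_le_sum_of_subset_of_nonneg (Finset.subset_univ _) fun _ _ _ => hF _ _ _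

end MeasureAndReprogram

/-! ## Success probabilities of measure-and-reprogram reductions -/

section Success

variable {κ N q : ℕ} {Inst Com Chal Rsp Msg X : Type} {Sig : KeyRing κ Inst → Type}
  [Fintype X] [DecidableEq X] [Fintype Com] [DecidableEq Com] [Nonempty Com]
  [Fintype Chal] [DecidableEq Chal] [AddCommGroup Chal]
  (A : NRAAdversary N q Msg Sig X Chal) (pk : Fin N → Inst)

theorem NRAAdversary.state_eq_scheduled (H : X → Chal) (n : ℕ) :
    A.state pk H n =
      applyMatrix (A.step pk n).1 (A.scheduled pk (fun _ => none) n) H := by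
  induction n with
  | zero => rfl
  | succ n ih =>
    rw [NRAAdversary.state, ih]
    rfl

theorem NRAAdversary.committedPass_measured {ext : ℕ → Prop} {τ : ℕ → Option X}
    (hτ : ∀ k, ext k ↔ τ k ≠ none) {T : ℕ} (hT : T < q) {x : X} (hx : τ T = some x)
    (g : (Fin q → Option X) → Com) (H : X → Chal) (s : (X × Chal) × A.Work) :
    A.committedPass pk ext T (fun _ => g) (g (recordAt τ (T + 1)))
      (s, (H, (recordAt τ (T + 1), some (g (recordAt τ (T + 1)))))) =
      if s.1.1 = x then (((√(Fintype.card (X → Chal)))⁻¹ * scheduleFactor τ T : ℝ) : ℂ) *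
        applyMatrix (A.step pk T).1 (A.scheduled pk τ T) H s else 0 := by
  rw [NRAAdversary.committedPass, NRAAdversary.writtenPass, writeGate_apply,
    ← A.extractPass_measured (Com := Com) pk hτ hT hx]
  simp

theorem NRAAdversary.reprogramPass_measured {ext : ℕ → Prop} {τ : ℕ → Option X}
    (hτ : ∀ k, ext k ↔ τ k ≠ none) {T : ℕ} (hT : T < q) {x : X} (hx : τ T = some x)
    (hτT : ∀ k, T < k → τ k = none) (g : (Fin q → Option X) → Com) (θ : Chal) (H : X → Chal)
    (s : (X × Chal) × A.Work) :
    A.reprogramPass pk T θ (A.committedPass pk ext T (fun _ => g) (g (recordAt τ (T + 1)))) (q + 1)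
      (s, (H, (recordAt τ (T + 1), some (g (recordAt τ (T + 1)))))) =
      if H x = θ then ((√(Fintype.card Chal) * ((√(Fintype.card (X → Chal)))⁻¹ *
        scheduleFactor τ (T + 1)) : ℝ) : ℂ) *
          applyMatrix (A.step pk q).1 (A.scheduled pk τ q) H s else 0 := by
  rw [A.reprogramPass_apply pk hT hx hτT θ (A.committedPass_measured pk hτ hT hx g) H s,
    scheduleFactor, scheduleFactor, Finset.prod_range_succ, hx]
  congr 2
  push_cast
  simp
  ring

/-- Without measured queries the second pass is idle, and the memory contributes only the
normalisation of the uniform table. -/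
theorem NRAAdversary.reprogramPass_unmeasured {T : ℕ} (hT : T = q)
    (g : Forgery Msg Sig → (Fin q → Option X) → Com) (θ : Chal) (H : X → Chal)
    (s : (X × Chal) × A.Work) :
    A.reprogramPass pk T θ (A.committedPass pk (fun _ => False) T g (g (A.out s) fun _ => none))
      (q + 1) (s, (H, ((fun _ => none), some (g (A.out s) fun _ => none)))) =
        (((√(Fintype.card (X → Chal)))⁻¹ : ℝ) : ℂ) * A.state pk H q s := by
  subst hT
  have h := A.extractPass_last (Com := Com) pk (ext := fun _ => False) (τ := fun _ => none)
    (by simp) H s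
  have hr : (recordAt (fun _ => none) T : Fin T → Option X) = fun _ => none := by
    funext i
    simp [recordAt]
  have hf : scheduleFactor (fun _ => (none : Option X)) T = 1 := by simp [scheduleFactor]
  rw [hr, hf, mul_one, ← A.state_eq_scheduled] at h
  rw [A.reprogramPass_last, NRAAdversary.committedPass, NRAAdversary.writtenPass, writeGate_apply,
    ← h]
  simp

/-- At most `n` times are occupied, and each costs `1 / √2` in amplitude. -/
theorem inv_two_pow_le_scheduleFactor_sq {n m : ℕ} (x : Fin n → X) (t : Fin n → Fin m) (k : ℕ) :
    (1 / 2 : ℝ) ^ n ≤ scheduleFactor (schedule x t) k ^ 2 := by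
  have h1 : scheduleFactor (schedule x t) k ^ 2 =
      (1 / 2) ^ ((Finset.range k).filter fun i => schedule x t i ≠ none).card := by
    rw [scheduleFactor, ← Finset.prod_pow, Finset.card_eq_sum_ones, Finset.sum_filter,
      ← Finset.prod_pow_eq_pow_sum]
    refine Finset.prod_congr rfl fun i _ => ?_
    split_ifs <;> simp_all
  rw [h1]
  refine pow_le_pow_of_le_one (by norm_num) (by norm_num) ?_
  calc _ ≤ (Finset.univ.image fun j => (t j : ℕ)).card := Finset.card_le_card fun i hi => by
        obtain ⟨-, hi⟩ := Finset.mem_filter.mp hi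
        rw [ne_eq, schedule_eq_none] at hi
        push Not at hi
        simpa using hi
    _ ≤ n := by simpa using Finset.card_image_le (s := Finset.univ) (f := fun j => (t j : ℕ))

variable [Fintype Inst] {Wit St Coin : Type} [Fintype Coin] (coin : PMF Coin)
  (keys : View N Inst Coin → Fin N → Inst) (ext : View N Inst Coin → ℕ → Prop)
  (last : View N Inst Coin → ℕ)
  (commitment : View N Inst Coin → Forgery Msg Sig → (Fin q → Option X) → Com)
  (rsp : View N Inst Coin → Forgery Msg Sig → Rsp) (D : PMF Inst) (ω : Coin) (x : Inst)
  (u : Fin N → Inst) (S : SigmaProtocol Inst Wit St Com Chal Rsp)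

/-- If no query is measured, the commitment is that of the forger's output. -/
theorem le_successAt_unmeasured (hext : ext (ω, x, u) = fun _ => False)
    (hlast : last (ω, x, u) = q) :
    (Fintype.card Chal : ℝ)⁻¹ * ∑ ch : Chal, ∑ s : (X × Chal) × A.Work, ∑ H : X → Chal,
      (if S.verify x (commitment (ω, x, u) (A.out s) fun _ => none) ch
        (rsp (ω, x, u) (A.out s)) = true then
          (Fintype.card (X → Chal) : ℝ)⁻¹ * ‖A.state (keys (ω, x, u)) H q s‖ ^ 2 else 0) ≤
    ((measureReduction coin keys ext last commitment rsp).toImpAdversary D A).successAt S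
      (ω, u) x := by
  refine le_trans (le_of_eq ?_) (le_successAt_measureReduction A coin keys ext last commitment rsp
    D ω x u S (fun _ _ => none) fun s => commitment (ω, x, u) (A.out s) fun _ => none)
  simp only [hext, A.reprogramPass_unmeasured _ hlast, norm_mul, mul_pow, Complex.norm_real,
    Real.norm_eq_abs, sq_abs, inv_pow, Real.sq_sqrt (Nat.cast_nonneg _)]

open Classical in
/-- If `n` queries are measured, the success probability is at least the probability of a scheduled
run, up to the factor `2 ^ n`. -/
theorem le_successAt_measured {n : ℕ} {t : Fin n → Fin q} (ht : Function.Injective t)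
    (hext : ext (ω, x, u) = fun k => ∃ j, (t j : ℕ) = k) {l : Fin n}
    (hl : ∀ j, t j ≤ t l) (hlast : last (ω, x, u) = t l) {g : (Fin q → Option X) → Com}
    (hg : commitment (ω, x, u) = fun _ => g) (good : (X × Chal) × A.Work → Prop)
    (p : (X × Chal) × A.Work → Fin n → X) (c : (X × Chal) × A.Work → Com)
    (hc : ∀ s, good s → ∀ r : Fin q → Option X, (∀ j, r (t j) = some (p s j)) → g r = c s) :
    ∑ s : (X × Chal) × A.Work, ∑ H : X → Chal,
      (if good s ∧ S.verify x (c s) (H (p s l)) (rsp (ω, x, u) (A.out s)) = true then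
        (1 / 2 : ℝ) ^ n * ((Fintype.card (X → Chal) : ℝ)⁻¹ *
          ‖applyMatrix (A.step (keys (ω, x, u)) q).1
            (A.scheduled (keys (ω, x, u)) (schedule (p s) t) q) H s‖ ^ 2) else 0) ≤
    ((measureReduction coin keys ext last commitment rsp).toImpAdversary D A).successAt S
      (ω, u) x := by
  have hM : (Fintype.card Chal : ℝ) ≠ 0 := by simp
  refine le_trans ?_ (le_successAt_measureReduction A coin keys ext last commitment rsp
    D ω x u S (fun s => recordAt (schedule (p s) t) (t l + 1))
      fun s => g (recordAt (schedule (p s) t) (t l + 1)))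
  rw [Finset.sum_comm (s := (Finset.univ : Finset Chal)), Finset.mul_sum]
  refine Finset.sum_le_sum fun s _ => ?_
  rw [Finset.sum_comm (s := (Finset.univ : Finset Chal)), Finset.mul_sum]
  refine Finset.sum_le_sum fun H _ => ?_
  split_ifs with h
  · obtain ⟨hs, hV⟩ := h
    have hrec : g (recordAt (schedule (p s) t) (t l + 1)) = c s := hc s hs _ fun j => by
      rw [recordAt, if_pos (Nat.lt_succ_of_le (hl j)), schedule_apply _ ht]
    have hτ : ∀ k, ext (ω, x, u) k ↔ schedule (p s) t k ≠ none := fun k => by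
      rw [hext, ne_eq, schedule_eq_none]
      push Not
      rfl
    have hτl : ∀ k, (t l : ℕ) < k → schedule (p s) t k = none := fun k hk =>
      schedule_eq_none.mpr fun j hj => by
        have := Fin.le_def.mp (hl j)
        omega
    rw [hlast, hg]
    simp only [A.reprogramPass_measured (keys (ω, x, u)) hτ (t l).isLt (schedule_apply (p s) ht l)
      hτl g]
    -- For a given final table only the challenge equal to its entry at the last point contributes.
    -- The square of the factor `√|Chal|` then cancels the probability of this challenge. The points
    -- may depend on `s`, since the records need only match afterwards.
    rw [Finset.sum_eq_single (H (p s l))]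
    · rw [hrec, if_pos hV, if_pos rfl, norm_mul, mul_pow, Complex.norm_real, Real.norm_eq_abs,
        sq_abs, mul_pow, mul_pow, inv_pow, Real.sq_sqrt (Nat.cast_nonneg _),
        Real.sq_sqrt (Nat.cast_nonneg _), ← mul_assoc, ← mul_assoc, inv_mul_cancel_left₀ hM,
        mul_comm ((1 / 2 : ℝ) ^ n)]
      have := inv_two_pow_le_scheduleFactor_sq (p s) t (t l + 1)
      gcongr
    · intro θ _ hθ
      simp [hθ.symm]
    · simp
  · exact mul_nonneg (by positivity) (Finset.sum_nonneg fun ch _ => by split_ifs <;> positivity)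

end Success

/-! ## Decomposing a run along the points of a signature -/

section Decomposition

variable {X C W : Type} [Fintype X] [DecidableEq X] [Fintype C] [DecidableEq C] [AddCommGroup C]
  [Fintype W]

theorem centre_applyMatrix {n : ℕ} (x : Fin n → X) (U : Matrix ((X × C) × W) ((X × C) × W) ℂ)
    (ψ : PurifiedAmp X C W) : centre x (applyMatrix U ψ) = applyMatrix U (centre x ψ) := by
  induction n with
  | zero => rfl
  | succ n ih => rw [centre, centre, ih, map_sub, applyMatrix_average]

theorem norm_sum_sq_le {ι : Type} [Fintype ι] (a : ι → ℂ) :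
    ‖∑ i, a i‖ ^ 2 ≤ Fintype.card ι * ∑ i, ‖a i‖ ^ 2 :=
  (pow_le_pow_left₀ (norm_nonneg _) (norm_sum_le _ _) 2).trans sq_sum_le_card_mul_sum_sq

open Classical in
/-- The probability that the oracle values at the points `x j` satisfy given conditions is bounded
by contributions in which one of these values is uniform, and by runs in which the queries at all
of the points are extracted. -/
theorem sum_norm_run_sq_le (U : ℕ → Matrix ((X × C) × W) ((X × C) × W) ℂ)
    (init : (X × C) × W → ℂ) (q : ℕ) {n : ℕ} {x : Fin n → X} (hx : Function.Injective x)
    (V : Fin n → C → Prop) (s : (X × C) × W) :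
    ∑ H : X → C, (if ∀ j, V j (H (x j)) then
      ‖applyMatrix (U q) (scheduledRun U init (fun _ => none) q) H s‖ ^ 2 else 0) ≤
    (q ^ n + n) *
      (∑ t : Fin n → Fin q, (if Function.Injective t then
        ∑ H : X → C, (if ∀ j, V j (H (x j)) then
          ‖applyMatrix (U q) (scheduledRun U init (schedule x t) q) H s‖ ^ 2 else 0) else 0) +
      ∑ j, (Fintype.card C : ℝ)⁻¹ * ∑ c, ∑ H : X → C, (if V j c then
        ‖applyMatrix (U q) (scheduledRun U init (fun _ => none) q) H s‖ ^ 2 else 0)) := by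
  obtain ⟨g, hg₁, hg₂, hg₃⟩ := exists_eq_centre_add_sum x
    (applyMatrix (U q) (scheduledRun U init (fun _ => none) q))
  rw [centre_applyMatrix, centre_scheduledRun U init hx] at hg₃
  set ψ := applyMatrix (U q) (scheduledRun U init (fun _ => none) q)
  -- Non-injective tuples get the value zero, so that Cauchy–Schwarz runs over an index set with
  -- exactly `q ^ n + n` elements.
  let z : (Fin n → Fin q) → PurifiedAmp X C W := fun t =>
    if Function.Injective t then applyMatrix (U q) (scheduledRun U init (schedule x t) q) else 0
  have hψ : ψ = ∑ i : (Fin n → Fin q) ⊕ Fin n, Sum.elim z g i := by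
    rw [hg₃, Fintype.sum_sum_type, map_sum, Finset.sum_filter]
    rfl
  have hpt : ∀ H, (if ∀ j, V j (H (x j)) then ‖ψ H s‖ ^ 2 else 0) ≤
      (q ^ n + n) * (∑ t, (if ∀ j, V j (H (x j)) then ‖z t H s‖ ^ 2 else 0) +
        ∑ j, if V j (H (x j)) then ‖g j H s‖ ^ 2 else 0) := by
    intro H
    split_ifs with h
    · have h1 : ψ H s = ∑ i : (Fin n → Fin q) ⊕ Fin n, Sum.elim z g i H s := by
        rw [hψ]
        simp only [Finset.sum_apply]
      rw [h1]
      refine (norm_sum_sq_le _).trans (le_of_eq ?_)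
      rw [Fintype.sum_sum_type]
      simp [h]
    · refine mul_nonneg (by positivity) (add_nonneg ?_ ?_)
      · simp
      · exact Finset.sum_nonneg fun j _ => by split_ifs <;> positivity
  refine (Finset.sum_le_sum fun H _ => hpt H).trans ?_
  rw [← Finset.mul_sum, Finset.sum_add_distrib]
  refine mul_le_mul_of_nonneg_left (add_le_add (le_of_eq ?_) ?_) (by positivity)
  · rw [Finset.sum_comm]
    refine Finset.sum_congr rfl fun t _ => ?_
    by_cases ht : Function.Injective t
    · simp only [z, if_pos ht]
    · simp [z, if_neg ht]
  · rw [Finset.sum_comm]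
    refine Finset.sum_le_sum fun j _ => ?_
    -- As `g j` ignores the entry at `x j`, this entry may be resampled; the condition on it then
    -- concerns an independent uniform value.
    rw [sum_eq_sum_update (x j)]
    refine mul_le_mul_of_nonneg_left ?_ (by positivity)
    rw [Finset.sum_comm]
    refine Finset.sum_le_sum fun c _ => ?_
    simp only [Function.update_self, hg₁]
    split_ifs
    · exact hg₂ j s
    · simp

end Decomposition

/-! ## Independent samples -/

section Samples

theorem PMF.map_apply_of_injective {α β : Type*} (p : PMF α) {f : α → β}
    (hf : Function.Injective f) (a : α) : p.map f (f a) = p a := by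
  classical
  rw [PMF.map_apply, tsum_eq_single a]
  · simp
  · intro b hb
    rw [if_neg fun h => hb (hf h).symm]

theorem iidPMF_apply {α : Type} (p : PMF α) (n : ℕ) (v : Fin n → α) :
    iidPMF p n v = ∏ i, p (v i) := by
  classical
  induction n with
  | zero =>
    rw [iidPMF, PMF.pure_apply, if_pos (Subsingleton.elim _ _)]
    rfl
  | succ n ih =>
    obtain ⟨a, v, rfl⟩ : ∃ a v', v = Fin.cons a v' :=
      ⟨v 0, Fin.tail v, (Fin.cons_self_tail v).symm⟩
    have hinj : Function.Injective fun v : Fin n → α => (Fin.cons a v : Fin (n + 1) → α) :=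
      Fin.cons_right_injective (α := fun _ => α) a
    rw [iidPMF, PMF.bind_apply, tsum_eq_single a, Fin.prod_univ_succ,
      PMF.map_apply_of_injective (iidPMF p n) hinj v, ih]
    · simp
    · intro b hb
      rw [PMF.map_apply, ENNReal.tsum_eq_zero.mpr, mul_zero]
      intro v'
      rw [if_neg]
      intro h
      exact hb (by simpa using (congrFun h 0).symm)

theorem sum_toReal_eq_one {α : Type} [Fintype α] (p : PMF α) : ∑ a, (p a).toReal = 1 := by
  rw [← ENNReal.toReal_sum fun a _ => p.apply_ne_top a, ← tsum_fintype (L := .unconditional _),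
    p.tsum_coe, ENNReal.toReal_one]

/-- Replacing one of several independent samples by a fresh one does not change their joint
distribution. -/
theorem sum_iidPMF_update {α : Type} [Fintype α] [DecidableEq α] (p : PMF α) {n : ℕ} (e : Fin n)
    (F : (Fin n → α) → ℝ) :
    ∑ x, (p x).toReal * ∑ u, (iidPMF p n u).toReal * F (Function.update u e x) =
      ∑ v, (iidPMF p n v).toReal * F v := by
  -- Exchanging the fresh sample with the one it replaces preserves the product weight; the
  -- discarded sample then sums to one.
  let E : (Fin n → α) × α ≃ (Fin n → α) × α :=
    { toFun := fun r => (Function.update r.1 e r.2, r.1 e)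
      invFun := fun r => (Function.update r.1 e r.2, r.1 e)
      left_inv := fun r => by simp
      right_inv := fun r => by simp }
  have hw : ∀ r : (Fin n → α) × α, (p (E r).2).toReal * (iidPMF p n (E r).1).toReal =
      (p r.2).toReal * (iidPMF p n r.1).toReal := by
    rintro ⟨u, x⟩
    simp only [E, Equiv.coe_fn_mk, iidPMF_apply, ← ENNReal.toReal_mul]
    congr 1
    rw [Fintype.prod_eq_mul_prod_compl e, Fintype.prod_eq_mul_prod_compl e, Function.update_self,
      Finset.prod_congr rfl fun i hi => by
        rw [Function.update_of_ne (by simpa using hi)]]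
    ring
  have h1 : ∑ r : (Fin n → α) × α, (p r.2).toReal * (iidPMF p n r.1).toReal *
      F (Function.update r.1 e r.2) =
      ∑ r : (Fin n → α) × α, (p r.2).toReal * (iidPMF p n r.1).toReal * F r.1 := by
    rw [← E.sum_comp]
    refine Finset.sum_congr rfl fun r _ => ?_
    rw [hw]
    simp [E]
  simp only [Finset.mul_sum, ← mul_assoc]
  rw [Finset.sum_comm, ← Fintype.sum_prod_type', h1, Fintype.sum_prod_type]
  refine Finset.sum_congr rfl fun v _ => ?_
  simp only [mul_assoc]
  rw [← Finset.sum_mul, sum_toReal_eq_one, one_mul]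

end Samples

/-! ## Forgeries for `AOS` -/

section Forgeries

variable {κ : ℕ} {Inst Com Rsp Msg : Type} [Nonempty Com] [Nonempty Rsp]

open Classical in
/-- The position of an instance in a ring. -/
noncomputable def ringPosition (ρ : KeyRing κ Inst) (x : Inst) : Option (Fin (ρ.1.val + 1)) :=
  if h : ∃ j, ρ.2 j = x then some h.choose else none

theorem ringPosition_apply (ρ : KeyRing κ Inst) (j : Fin (ρ.1.val + 1)) :
    ringPosition ρ (ρ.2 j) = some j := by
  have h : ∃ i, ρ.2 i = ρ.2 j := ⟨j, rfl⟩
  rw [ringPosition, dif_pos h]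
  exact congrArg some (ρ.2.injective h.choose_spec)

/-- The commitment that a forgery contains for a given ring member. -/
noncomputable def forgeryCom (x : Inst) (f : Forgery Msg (AOSSig Com Rsp (κ := κ) (Inst := Inst))) :
    Com :=
  ((ringPosition f.1 x).map fun j => (f.2.2 j).1).getD (Classical.arbitrary Com)

/-- The response that a forgery contains for a given ring member. -/
noncomputable def forgeryRsp (x : Inst) (f : Forgery Msg (AOSSig Com Rsp (κ := κ) (Inst := Inst))) :
    Rsp :=
  ((ringPosition f.1 x).map fun j => (f.2.2 j).2).getD (Classical.arbitrary Rsp)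

theorem forgeryCom_apply (f : Forgery Msg (AOSSig Com Rsp (κ := κ) (Inst := Inst)))
    (j : Fin (f.1.1.val + 1)) : forgeryCom (f.1.2 j) f = (f.2.2 j).1 := by
  simp [forgeryCom, ringPosition_apply]

theorem forgeryRsp_apply (f : Forgery Msg (AOSSig Com Rsp (κ := κ) (Inst := Inst)))
    (j : Fin (f.1.1.val + 1)) : forgeryRsp (f.1.2 j) f = (f.2.2 j).2 := by
  simp [forgeryRsp, ringPosition_apply]

/-- The point at which the hash function gives the challenge of a ring position. -/
def forgeryPoint (f : Forgery Msg (AOSSig Com Rsp (κ := κ) (Inst := Inst)))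
    (j : Fin (f.1.1.val + 1)) : HashInput κ Inst Com Msg :=
  (⟨j.val, lt_of_lt_of_le j.isLt f.1.1.isLt⟩, f.1, (f.2.2 (j - 1)).1, f.2.1)

theorem forgeryPoint_injective (f : Forgery Msg (AOSSig Com Rsp (κ := κ) (Inst := Inst))) :
    Function.Injective (forgeryPoint f) := by
  intro i j h
  have h1 := congrArg (fun p : HashInput κ Inst Com Msg => p.1.val) h
  exact Fin.ext h1

variable {Wit St Chal : Type}

theorem wins_AOS_iff [Fintype Inst] [DecidableEq Inst] [Fintype Com] [DecidableEq Com] [Fintype Msg]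
    [DecidableEq Msg] [Fintype Chal] [DecidableEq Chal] {N : ℕ}
    (S : SigmaProtocol Inst Wit St Com Chal Rsp) (Sim : Inst → Chal → PMF (Com × Rsp))
    (pk : Fin N → Inst) (H : HashInput κ Inst Com Msg → Chal)
    (f : Forgery Msg (AOSSig Com Rsp (κ := κ) (Inst := Inst))) :
    (AOS κ Msg S Sim).Wins pk H f ↔ (∀ j, f.1.2 j ∈ Set.range pk) ∧
      ∀ j, S.verify (f.1.2 j) (f.2.2 j).1 (H (forgeryPoint f j)) (f.2.2 j).2 = true := by
  exact and_congr_right fun _ => decide_eq_true_iff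

end Forgeries

/-! ## The reduction for `AOS` -/

section Reduction

/-- The queries that are measured: none, or one query for every position of a ring with `n + 1`
members. -/
abbrev ExtractionMode (N q : ℕ) : Type := Option (Σ n : Fin N, Fin (n.val + 1) → Fin q)

/-- The position whose query is the last one. -/
noncomputable def lastPosition {n q : ℕ} (t : Fin (n + 1) → Fin q) : Fin (n + 1) :=
  (Finite.exists_max t).choose

theorem le_lastPosition {n q : ℕ} (t : Fin (n + 1) → Fin q) (j : Fin (n + 1)) :
    t j ≤ t (lastPosition t) :=
  (Finite.exists_max t).choose_spec j

variable {κ N q : ℕ} {Inst Com Chal Rsp Msg : Type}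

/-- Whether the query number `k` is measured. -/
def ExtractionMode.IsTime : ExtractionMode N q → ℕ → Prop
  | none => fun _ => False
  | some nt => fun k => ∃ j, (nt.2 j : ℕ) = k

/-- The number of the last measured query. -/
noncomputable def ExtractionMode.last : ExtractionMode N q → ℕ
  | none => q
  | some nt => nt.2 (lastPosition nt.2)

/-- The commitment to be sent: that of the forgery, or one contained in a measured query. -/
noncomputable def ExtractionMode.commitment [Nonempty Com] (x : Inst) :
    ExtractionMode N q → Forgery Msg (AOSSig Com Rsp (κ := κ) (Inst := Inst)) →
      (Fin q → Option (HashInput κ Inst Com Msg)) → Com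
  | none => fun f _ => forgeryCom x f
  | some nt => fun _ r =>
      -- The commitment of position `l` is part of the hash input of its cyclic successor, whose
      -- query is not later than that of `l`. In a ring with one member it is the same query.
      -- Choosing the last position thus makes the commitment available before the challenge is
      -- needed.
      ((r (nt.2 (lastPosition nt.2 + 1))).map fun p => p.2.2.1).getD (Classical.arbitrary Com)

variable [Fintype Inst] [DecidableEq Inst] [Fintype Com] [DecidableEq Com] [Nonempty Com]
  [Fintype Chal] [DecidableEq Chal] [AddCommGroup Chal] [Nonempty Rsp]
  [Fintype Msg] [DecidableEq Msg]

variable (κ N q Inst Com Chal Rsp Msg) in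
/-- The reduction for `AOS`: the instance is placed at a random position of the key vector, and the
measured queries are random. -/
noncomputable def aosReduction [NeZero N] :
    BlackBoxReduction (κ := κ) N q Inst Com Chal Rsp Msg (AOSSig Com Rsp)
      (HashInput κ Inst Com Msg) :=
  measureReduction (Coin := Fin N × ExtractionMode N q) (PMF.uniformOfFintype _)
    (fun v => Function.update v.2.2 v.1.1 v.2.1) (fun v => v.1.2.IsTime) (fun v => v.1.2.last)
    (fun v => v.1.2.commitment v.2.1) (fun v f => forgeryRsp v.2.1 f)

variable {Wit St : Type} (S : SigmaProtocol Inst Wit St Com Chal Rsp)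
  (A : NRAAdversary (κ := κ) (PK := Inst) N q Msg (AOSSig Com Rsp) (HashInput κ Inst Com Msg) Chal)
  (pk : Fin N → Inst) (e : Fin N)

open Classical in
/-- The contribution of a final state of the forger to the success probability, when the instance
has position `e` in the key vector. -/
noncomputable def modeTerm (s : (HashInput κ Inst Com Msg × Chal) × A.Work) :
    ExtractionMode N q → ℝ
  | none => (Fintype.card Chal : ℝ)⁻¹ * ∑ ch : Chal, ∑ H : HashInput κ Inst Com Msg → Chal,
      if S.verify (pk e) (forgeryCom (pk e) (A.out s)) ch (forgeryRsp (pk e) (A.out s)) = true then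
        (Fintype.card (HashInput κ Inst Com Msg → Chal) : ℝ)⁻¹ * ‖A.state pk H q s‖ ^ 2 else 0
  | some nt => if Function.Injective nt.2 then ∑ H : HashInput κ Inst Com Msg → Chal,
      if ((A.out s).1.1.val = nt.1.val ∧
        -- The guessed ring size and that of the forgery are indices of different types; `Fin.ofNat`
        -- translates positions, faithfully once the preceding equality of sizes holds.
        (A.out s).1.2 (Fin.ofNat _ (lastPosition nt.2).val) = pk e) ∧
        S.verify (pk e) ((A.out s).2.2 (Fin.ofNat _ (lastPosition nt.2).val)).1
          (H (forgeryPoint (A.out s) (Fin.ofNat _ (lastPosition nt.2).val)))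
          (forgeryRsp (pk e) (A.out s)) = true then
        (1 / 2 : ℝ) ^ (nt.1.val + 1) *
          ((Fintype.card (HashInput κ Inst Com Msg → Chal) : ℝ)⁻¹ *
            ‖applyMatrix (A.step pk q).1 (A.scheduled pk (schedule
              (fun j => forgeryPoint (A.out s) (Fin.ofNat _ j.val)) nt.2) q) H s‖ ^ 2) else 0
      else 0

theorem modeTerm_nonneg (s : (HashInput κ Inst Com Msg × Chal) × A.Work)
    (M : ExtractionMode N q) : 0 ≤ modeTerm S A pk e s M := by
  cases M with
  | none =>
    rw [modeTerm]
    refine mul_nonneg (by positivity) (Finset.sum_nonneg fun _ _ => Finset.sum_nonneg fun _ _ => ?_)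
    split_ifs <;> positivity
  | some nt =>
    rw [modeTerm]
    split_ifs
    · refine Finset.sum_nonneg fun _ _ => ?_
      split_ifs <;> positivity
    · exact le_rfl

/-- Translating the successor of `l` and stepping back gives `l`, also at the wrap-around, provided
that the sizes agree. This identifies the commitment read from the measured query with that of the
forgery. -/
theorem ofNat_add_one_sub_one {m n : ℕ} (h : m = n) (l : Fin (n + 1)) :
    Fin.ofNat (m + 1) (l + 1).val - 1 = Fin.ofNat (m + 1) l.val := by
  subst h
  simp

/-- The instance `x` sits at position `e` of the key vector, and the two kinds of modes correspond
to the two lower bounds on the success probability. Modes with coinciding times contribute zero. -/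
theorem sum_modeTerm_le_successAt [NeZero N] (D : PMF Inst) (M : ExtractionMode N q) (x : Inst)
    (u : Fin N → Inst) :
    ∑ s, modeTerm S A (Function.update u e x) e s M ≤
      ((aosReduction κ N q Inst Com Chal Rsp Msg).toImpAdversary D A).successAt S
        ((e, M), u) x := by
  cases M with
  | none =>
    refine le_trans (le_of_eq ?_) (le_successAt_unmeasured A
      (PMF.uniformOfFintype (Fin N × ExtractionMode N q))
      (fun v => Function.update v.2.2 v.1.1 v.2.1) (fun v => v.1.2.IsTime) (fun v => v.1.2.last)
      (fun v => v.1.2.commitment v.2.1) (fun v f => forgeryRsp v.2.1 f) D (e, none) x u S rfl rfl)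
    simp only [modeTerm, Function.update_self]
    rw [← Finset.mul_sum, Finset.sum_comm]
    rfl
  | some nt =>
    obtain ⟨n, t⟩ := nt
    by_cases ht : Function.Injective t
    · refine le_trans (le_of_eq ?_) (le_successAt_measured A
        (PMF.uniformOfFintype (Fin N × ExtractionMode N q))
        (fun v => Function.update v.2.2 v.1.1 v.2.1) (fun v => v.1.2.IsTime) (fun v => v.1.2.last)
        (fun v => v.1.2.commitment v.2.1) (fun v f => forgeryRsp v.2.1 f) D (e, some ⟨n, t⟩) x u S
        ht rfl (le_lastPosition t) rfl rfl
        (fun s => (A.out s).1.1.val = n.val ∧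
          (A.out s).1.2 (Fin.ofNat _ (lastPosition t).val) = x)
        (fun s j => forgeryPoint (A.out s) (Fin.ofNat _ j.val))
        (fun s => ((A.out s).2.2 (Fin.ofNat _ (lastPosition t).val)).1) ?_)
      · simp only [modeTerm, Function.update_self, if_pos ht]
      · rintro s ⟨hs, -⟩ r hr
        rw [hr]
        simp only [forgeryPoint, Option.map_some, Option.getD_some]
        rw [ofNat_add_one_sub_one hs]
    · simp only [modeTerm, if_neg ht, Finset.sum_const_zero]
      refine Finset.sum_nonneg fun c _ => mul_nonneg (by positivity)
        (Finset.sum_nonneg fun _ _ => Finset.sum_nonneg fun _ _ => ?_)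
      split_ifs <;> positivity

end Reduction

/-! ## The loss of the reduction -/

section Loss

/-- The number of summands in Cauchy–Schwarz times the loss from the commutators, made uniform in
the ring size by `n ≤ n ^ n` and superadditivity of powers. -/
theorem pow_succ_add_succ_mul_two_pow_le {q N m : ℕ} (hm : m + 1 ≤ N) :
    ((q : ℝ) ^ (m + 1) + ((m + 1 : ℕ) : ℝ)) * 2 ^ (m + 1) ≤ (q + N) ^ N * 2 ^ N := by
  have h1 : ((m + 1 : ℕ) : ℝ) ≤ ((m + 1 : ℕ) : ℝ) ^ (m + 1) := by
    exact_mod_cast Nat.le_self_pow (Nat.succ_ne_zero m) (m + 1)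
  have h2 : (q : ℝ) ^ (m + 1) + ((m + 1 : ℕ) : ℝ) ^ (m + 1) ≤ (q + ((m + 1 : ℕ) : ℝ)) ^ (m + 1) :=
    pow_add_pow_le (by positivity) (by positivity) (Nat.succ_ne_zero m)
  have h3 : ((m + 1 : ℕ) : ℝ) ≤ N := by exact_mod_cast hm
  have h4 : (1 : ℝ) ≤ ((m + 1 : ℕ) : ℝ) := by exact_mod_cast Nat.le_add_left 1 m
  have h5 : (q + ((m + 1 : ℕ) : ℝ)) ^ (m + 1) ≤ ((q : ℝ) + N) ^ N := by
    calc _ ≤ ((q : ℝ) + N) ^ (m + 1) := by gcongr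
      _ ≤ _ := pow_le_pow_right₀ (by linarith [(Nat.cast_nonneg q : (0 : ℝ) ≤ q)]) hm
  have h6 : (2 : ℝ) ^ (m + 1) ≤ 2 ^ N := pow_le_pow_right₀ (by norm_num) hm
  gcongr
  linarith

/-- The count is the geometric sum of the powers of `q` up to `q ^ N`. -/
theorem card_extractionMode_le (N q : ℕ) : Fintype.card (ExtractionMode N q) ≤ (q + 1) ^ N := by
  rw [Fintype.card_option, Fintype.card_sigma]
  simp only [Fintype.card_fun, Fintype.card_fin]
  induction N with
  | zero => simp
  | succ N ih =>
    rw [Fin.sum_univ_castSucc]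
    simp only [Fin.val_castSucc, Fin.val_last]
    have h : q ^ (N + 1) ≤ q * (q + 1) ^ N := by
      rw [pow_succ']
      exact Nat.mul_le_mul_left _ (Nat.pow_le_pow_left (Nat.le_succ q) N)
    calc _ ≤ (q + 1) ^ N + q * (q + 1) ^ N := by omega
      _ = _ := by ring

theorem two_mul_le_two_pow {N : ℕ} (hN : N ≠ 0) : 2 * N ≤ 2 ^ N := by
  obtain ⟨n, rfl⟩ := Nat.exists_eq_succ_of_ne_zero hN
  rw [pow_succ']
  exact Nat.mul_le_mul_left 2 Nat.lt_two_pow_self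

/-- The factor `1 / 2` comes from `2 * N ≤ 2 ^ N`: the guess of the key index is absorbed into a
power of two, and the two `N`-th powers combine. -/
theorem loss_le {N q qH : ℕ} (hN : N ≠ 0) (hq : q ≤ qH) :
    (N * Fintype.card (ExtractionMode N q) : ℝ) * (((q : ℝ) + N) ^ N * 2 ^ N) ≤
      1 / 2 * (2 * ((qH : ℝ) + N) + 1) ^ (2 * N) := by
  have hN1 : (1 : ℝ) ≤ N := by exact_mod_cast Nat.one_le_iff_ne_zero.mpr hN
  have hqH : (q : ℝ) ≤ qH := by exact_mod_cast hq
  have h1 : (Fintype.card (ExtractionMode N q) : ℝ) ≤ ((q : ℝ) + 1) ^ N := by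
    exact_mod_cast card_extractionMode_le N q
  have h2 : 2 * (N : ℝ) ≤ 2 ^ N := by exact_mod_cast two_mul_le_two_pow hN
  calc (N * Fintype.card (ExtractionMode N q) : ℝ) * (((q : ℝ) + N) ^ N * 2 ^ N)
      ≤ (1 / 2 * 2 ^ N * ((q : ℝ) + N) ^ N) * (((q : ℝ) + N) ^ N * 2 ^ N) := by
        gcongr
        · linarith
        · exact h1.trans (by gcongr)
    _ = 1 / 2 * (2 * ((q : ℝ) + N)) ^ (2 * N) := by rw [mul_comm 2 N, pow_mul, mul_pow]; ring
    _ ≤ _ := by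
        gcongr
        linarith

end Loss

/-! ### The decomposition bound for a run of the forger. -/

section Forger

variable {κ N q : ℕ} {Inst Chal Msg X : Type} {Sig : KeyRing κ Inst → Type}
  [Fintype X] [DecidableEq X] [Fintype Chal] [DecidableEq Chal] [AddCommGroup Chal]

open Classical in
theorem NRAAdversary.sum_norm_state_sq_le (A : NRAAdversary N q Msg Sig X Chal)
    (pk : Fin N → Inst) {n : ℕ} {x : Fin n → X} (hx : Function.Injective x)
    (V : Fin n → Chal → Prop) (s : (X × Chal) × A.Work) :
    ∑ H : X → Chal, (if ∀ j, V j (H (x j)) then ‖A.state pk H q s‖ ^ 2 else 0) ≤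
    (q ^ n + n) *
      (∑ t : Fin n → Fin q, (if Function.Injective t then
        ∑ H : X → Chal, (if ∀ j, V j (H (x j)) then
          ‖applyMatrix (A.step pk q).1 (A.scheduled pk (schedule x t) q) H s‖ ^ 2 else 0) else 0) +
      ∑ j, (Fintype.card Chal : ℝ)⁻¹ * ∑ c, ∑ H : X → Chal, (if V j c then
        ‖A.state pk H q s‖ ^ 2 else 0)) := by
  simp only [A.state_eq_scheduled]
  exact sum_norm_run_sq_le (fun k => (A.step pk k).1) (Pi.single A.start 1) q hx V s

end Forger

/-! ### The security bound for `AOS`. -/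

section Security

variable {κ N q : ℕ} {Inst Com Chal Rsp Msg : Type}
  [Fintype Inst] [DecidableEq Inst] [Fintype Com] [DecidableEq Com] [Nonempty Com]
  [Fintype Chal] [DecidableEq Chal] [AddCommGroup Chal] [Nonempty Rsp]
  [Fintype Msg] [DecidableEq Msg] {Wit St : Type} (S : SigmaProtocol Inst Wit St Com Chal Rsp)
  (Sim : Inst → Chal → PMF (Com × Rsp))
  (A : NRAAdversary (κ := κ) (PK := Inst) N q Msg (AOSSig Com Rsp) (HashInput κ Inst Com Msg) Chal)
  (pk : Fin N → Inst)

open Classical in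
/-- The probability of ending in a given state with a valid forgery is bounded by the contributions
of that state to the success probabilities of the reduction. -/
theorem sum_wins_norm_sq_le (s : (HashInput κ Inst Com Msg × Chal) × A.Work) :
    (Fintype.card (HashInput κ Inst Com Msg → Chal) : ℝ)⁻¹ *
      ∑ H : HashInput κ Inst Com Msg → Chal,
        (if (AOS κ Msg S Sim).Wins pk H (A.out s) then ‖A.state pk H q s‖ ^ 2 else 0) ≤
    (((q : ℝ) + N) ^ N * 2 ^ N) * ∑ e, ∑ M : ExtractionMode N q, modeTerm S A pk e s M := by
  have hnn : 0 ≤ ∑ e, ∑ M : ExtractionMode N q, modeTerm S A pk e s M :=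
    Finset.sum_nonneg fun _ _ => Finset.sum_nonneg fun _ _ => modeTerm_nonneg S A pk _ s _
  by_cases hr : ∀ j, (A.out s).1.2 j ∈ Set.range pk
  swap
  · rw [Finset.sum_eq_zero fun H _ => if_neg fun h => hr ((wins_AOS_iff S Sim pk H _).mp h).1,
      mul_zero]
    positivity
  -- The map from ring positions to key indices is injective because ring members are distinct; this
  -- bounds the ring size by `N`.
  choose e he using hr
  have he_inj : Function.Injective e := fun i j hij =>
    (A.out s).1.2.injective (by rw [← he i, ← he j, hij])
  have hm : (A.out s).1.1.val + 1 ≤ N := by simpa using Fintype.card_le_of_injective e he_inj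
  let n : Fin N := ⟨(A.out s).1.1.val, hm⟩
  obtain ⟨V, hV⟩ : ∃ V : Fin ((A.out s).1.1.val + 1) → Chal → Prop, ∀ j c,
      V j c ↔ S.verify ((A.out s).1.2 j) ((A.out s).2.2 j).1 c ((A.out s).2.2 j).2 = true :=
    ⟨_, fun _ _ => Iff.rfl⟩
  have h1 := A.sum_norm_state_sq_le pk (forgeryPoint_injective (A.out s)) V s
  -- The reduction must have guessed the times `t` and the key index of the position queried last.
  -- Of all verification conditions only the one at that position is kept, and `2 ^ n` undoes the
  -- factor in `modeTerm`.
  have h2 : ∀ t : Fin ((A.out s).1.1.val + 1) → Fin q,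
      (Fintype.card (HashInput κ Inst Com Msg → Chal) : ℝ)⁻¹ *
        (if Function.Injective t then ∑ H : HashInput κ Inst Com Msg → Chal,
          (if ∀ j, V j (H (forgeryPoint (A.out s) j)) then
            ‖applyMatrix (A.step pk q).1 (A.scheduled pk
              (schedule (forgeryPoint (A.out s)) t) q) H s‖ ^ 2 else 0) else 0) ≤
      2 ^ ((A.out s).1.1.val + 1) * modeTerm S A pk (e (lastPosition t)) s (some ⟨n, t⟩) := by
    intro t
    by_cases ht : Function.Injective t
    · rw [modeTerm, if_pos ht, if_pos ht, Finset.mul_sum, Finset.mul_sum]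
      refine Finset.sum_le_sum fun H _ => ?_
      simp only [n, Fin.ofNat_val_eq_self, he, forgeryRsp_apply, true_and, ← hV]
      split_ifs with h h' h'
      · refine le_of_eq ?_
        rw [← mul_assoc ((2 : ℝ) ^ _), ← mul_pow]
        norm_num
      · exact absurd (h _) h'
      · rw [mul_zero]
        positivity
      · simp
    · rw [modeTerm, if_neg ht, if_neg ht, mul_zero, mul_zero]
  -- A remainder is matched by the mode that measures nothing, with the instance at position `j`.
  have h3 : ∀ j, (Fintype.card (HashInput κ Inst Com Msg → Chal) : ℝ)⁻¹ *
      ((Fintype.card Chal : ℝ)⁻¹ * ∑ c, ∑ H : HashInput κ Inst Com Msg → Chal,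
        (if V j c then
          ‖A.state pk H q s‖ ^ 2 else 0)) ≤
      2 ^ ((A.out s).1.1.val + 1) * modeTerm S A pk (e j) s none := by
    intro j
    refine le_trans (le_of_eq ?_) (le_mul_of_one_le_left (modeTerm_nonneg S A pk (e j) s none)
      (one_le_pow₀ one_le_two))
    rw [modeTerm, he, forgeryCom_apply, forgeryRsp_apply, mul_left_comm]
    simp only [Finset.mul_sum, mul_ite, mul_zero, hV]
  -- Different `t` belong to different modes and different `j` to different key indices, so the left
  -- side is part of a sum of nonnegative terms.
  have h4 : ∑ t : Fin ((A.out s).1.1.val + 1) → Fin q,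
        modeTerm S A pk (e (lastPosition t)) s (some ⟨n, t⟩) +
      ∑ j, modeTerm S A pk (e j) s none ≤
      ∑ e, ∑ M : ExtractionMode N q, modeTerm S A pk e s M := by
    simp only [Fintype.sum_option, Finset.sum_add_distrib]
    rw [add_comm]
    refine add_le_add ?_ ?_
    · rw [← Finset.sum_image (f := fun i => modeTerm S A pk i s none) he_inj.injOn]
      exact Finset.sum_le_sum_of_subset_of_nonneg (Finset.subset_univ _)
        fun _ _ _ => modeTerm_nonneg S A pk _ s _
    · rw [Finset.sum_comm]
      simp only [Fintype.sum_sigma]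
      refine le_trans ?_ (Finset.single_le_sum (f := fun n' : Fin N =>
        ∑ t : Fin (n'.val + 1) → Fin q, ∑ i, modeTerm S A pk i s (some ⟨n', t⟩))
        (fun _ _ => Finset.sum_nonneg fun _ _ => Finset.sum_nonneg fun _ _ =>
          modeTerm_nonneg S A pk _ s _) (Finset.mem_univ n))
      exact Finset.sum_le_sum fun t _ => Finset.single_le_sum
        (f := fun i => modeTerm S A pk i s (some ⟨n, t⟩))
        (fun _ _ => modeTerm_nonneg S A pk _ s _) (Finset.mem_univ _)
  have h0 : ∀ H, (if (AOS κ Msg S Sim).Wins pk H (A.out s) then ‖A.state pk H q s‖ ^ 2 else 0) =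
      if ∀ j, V j (H (forgeryPoint (A.out s) j)) then
        ‖A.state pk H q s‖ ^ 2 else 0 := fun H => by
    refine if_congr ?_ rfl rfl
    simp only [wins_AOS_iff, hV]
    exact and_iff_right fun j => ⟨e j, he j⟩
  simp only [h0]
  refine (mul_le_mul_of_nonneg_left h1 (inv_nonneg.mpr (Nat.cast_nonneg _))).trans ?_
  rw [mul_left_comm, mul_add, Finset.mul_sum, Finset.mul_sum]
  calc _ ≤ ((q : ℝ) ^ ((A.out s).1.1.val + 1) + (((A.out s).1.1.val + 1 : ℕ) : ℝ)) *
        (∑ t : Fin ((A.out s).1.1.val + 1) → Fin q, 2 ^ ((A.out s).1.1.val + 1) *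
            modeTerm S A pk (e (lastPosition t)) s (some ⟨n, t⟩) +
          ∑ j, 2 ^ ((A.out s).1.1.val + 1) * modeTerm S A pk (e j) s none) :=
        mul_le_mul_of_nonneg_left (add_le_add (Finset.sum_le_sum fun t _ => h2 t)
          (Finset.sum_le_sum fun j _ => h3 j)) (by positivity)
    _ = (((q : ℝ) ^ ((A.out s).1.1.val + 1) + (((A.out s).1.1.val + 1 : ℕ) : ℝ)) *
          2 ^ ((A.out s).1.1.val + 1)) *
        (∑ t : Fin ((A.out s).1.1.val + 1) → Fin q,
            modeTerm S A pk (e (lastPosition t)) s (some ⟨n, t⟩) +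
          ∑ j, modeTerm S A pk (e j) s none) := by
        rw [← Finset.mul_sum, ← Finset.mul_sum]
        ring
    _ ≤ _ := by
        refine mul_le_mul (pow_succ_add_succ_mul_two_pow_le hm) h4 ?_ (by positivity)
        exact add_nonneg (Finset.sum_nonneg fun _ _ => modeTerm_nonneg S A pk _ s _)
          (Finset.sum_nonneg fun _ _ => modeTerm_nonneg S A pk _ s _)

theorem impAdvantage_nonneg (B : ImpAdversary Inst Com Chal Rsp) : 0 ≤ impAdvantage S B := by
  unfold impAdvantage
  refine Finset.sum_nonneg fun _ _ => mul_nonneg ENNReal.toReal_nonneg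
    (Finset.sum_nonneg fun _ _ => mul_nonneg ENNReal.toReal_nonneg
      (Finset.sum_nonneg fun _ _ => mul_nonneg (by positivity)
        (Finset.sum_nonneg fun _ _ => Finset.sum_nonneg fun _ _ => ?_)))
  split_ifs <;> positivity

theorem PMF.bind_map_prodMk_apply {α β : Type*} (p : PMF α) (r : PMF β) (a : α) (b : β) :
    (p.bind fun a => r.map fun b => (a, b)) (a, b) = p a * r b := by
  rw [PMF.bind_apply, tsum_eq_single a]
  · rw [PMF.map_apply_of_injective r (Prod.mk_right_injective a)]
  · intro a' ha
    rw [PMF.map_apply, ENNReal.tsum_eq_zero.mpr, mul_zero]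
    intro b'
    rw [if_neg]
    intro h
    exact ha (congrArg Prod.fst h).symm

theorem impAdvantage_toImpAdversary {X : Type} [Fintype X] [DecidableEq X]
    {Sig : KeyRing κ Inst → Type} (R : BlackBoxReduction N q Inst Com Chal Rsp Msg Sig X)
    (A : NRAAdversary N q Msg Sig X Chal) (D : PMF Inst) :
    impAdvantage S (R.toImpAdversary D A) =
      ∑ ω, (R.coin ω).toReal * ∑ x, (S.instDist x).toReal * ∑ u, (iidPMF D N u).toReal *
        (R.toImpAdversary D A).successAt S (ω, u) x := by
  have h : impAdvantage S (R.toImpAdversary D A) = ∑ x, (S.instDist x).toReal *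
      ∑ ω : R.Coin × (Fin N → Inst), ((R.toImpAdversary D A).coin ω).toReal *
        (R.toImpAdversary D A).successAt S ω x := rfl
  have hcoin : ∀ ω u, ((R.toImpAdversary D A).coin (ω, u)).toReal =
      (R.coin ω).toReal * (iidPMF D N u).toReal := fun ω u => by
    rw [← ENNReal.toReal_mul]
    exact congrArg ENNReal.toReal (PMF.bind_map_prodMk_apply _ _ _ _)
  rw [h]
  simp only [Fintype.sum_prod_type, hcoin, Finset.mul_sum]
  rw [Finset.sum_comm]
  refine Finset.sum_congr rfl fun _ _ => Finset.sum_congr rfl fun _ _ =>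
    Finset.sum_congr rfl fun _ _ => ?_
  ring

/-- With uniform coins, the sum over all guesses is the number of guesses times the advantage.
Placing the challenge instance at position `e` leaves the keys independent samples, so the forger
sees its genuine input distribution. -/
theorem sum_modeTerm_le_impAdvantage [NeZero N] :
    ∑ pk, (iidPMF S.instDist N pk).toReal *
      ∑ s, ∑ e, ∑ M : ExtractionMode N q, modeTerm S A pk e s M ≤
    (N * Fintype.card (ExtractionMode N q)) *
      impAdvantage S ((aosReduction κ N q Inst Com Chal Rsp Msg).toImpAdversary S.instDist A) := by
  have hcoin : ∀ ω : Fin N × ExtractionMode N q,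
      ((aosReduction κ N q Inst Com Chal Rsp Msg).coin ω).toReal =
        ((N : ℝ) * Fintype.card (ExtractionMode N q))⁻¹ := fun ω => by
    refine (congrArg ENNReal.toReal (PMF.uniformOfFintype_apply ω)).trans ?_
    rw [Fintype.card_prod, Fintype.card_fin, ENNReal.toReal_inv, ENNReal.toReal_natCast,
      Nat.cast_mul]
  rw [impAdvantage_toImpAdversary]
  change _ ≤ _ * ∑ ω : Fin N × ExtractionMode N q, _
  simp only [hcoin]
  have hc : (N * Fintype.card (ExtractionMode N q) : ℝ) ≠ 0 :=
    mul_ne_zero (Nat.cast_ne_zero.mpr (NeZero.ne N)) (Nat.cast_ne_zero.mpr Fintype.card_ne_zero)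
  rw [← Finset.mul_sum, mul_inv_cancel_left₀ hc, Fintype.sum_prod_type]
  calc _ = ∑ e, ∑ M : ExtractionMode N q, ∑ pk, (iidPMF S.instDist N pk).toReal *
        ∑ s, modeTerm S A pk e s M := by
        simp only [Finset.mul_sum]
        rw [Finset.sum_congr rfl fun pk _ => Finset.sum_comm, Finset.sum_comm]
        refine Finset.sum_congr rfl fun e _ => ?_
        rw [Finset.sum_congr rfl fun pk _ => Finset.sum_comm, Finset.sum_comm]
    _ ≤ _ := by
        refine Finset.sum_le_sum fun e _ => Finset.sum_le_sum fun M _ => ?_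
        rw [← sum_iidPMF_update S.instDist e]
        gcongr with x _ u _
        exact sum_modeTerm_le_successAt S A e S.instDist M x u

theorem ufnraAdvantage_AOS_le [NeZero N] :
    ufnraAdvantage (AOS κ Msg S Sim) A ≤
      (N * Fintype.card (ExtractionMode N q) : ℝ) * (((q : ℝ) + N) ^ N * 2 ^ N) *
        impAdvantage S
          ((aosReduction κ N q Inst Com Chal Rsp Msg).toImpAdversary S.instDist A) := by
  classical
  calc _ ≤ (((q : ℝ) + N) ^ N * 2 ^ N) * ∑ pk, (iidPMF S.instDist N pk).toReal *
        ∑ s, ∑ e, ∑ M : ExtractionMode N q, modeTerm S A pk e s M := by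
        unfold ufnraAdvantage
        rw [Finset.mul_sum]
        refine Finset.sum_le_sum fun pk _ => ?_
        rw [mul_left_comm (((q : ℝ) + N) ^ N * 2 ^ N)]
        refine mul_le_mul_of_nonneg_left ?_ ENNReal.toReal_nonneg
        rw [Finset.sum_comm, Finset.mul_sum, Finset.mul_sum]
        exact Finset.sum_le_sum fun s _ => sum_wins_norm_sq_le S Sim A pk s
    _ ≤ _ := by
        refine (mul_le_mul_of_nonneg_left (sum_modeTerm_le_impAdvantage S A)
          (by positivity)).trans (le_of_eq ?_)
        ring

theorem ufnraAdvantage_AOS_eq_zero [IsEmpty (Fin N)] :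
    ufnraAdvantage (AOS κ Msg S Sim) A = 0 := by
  unfold ufnraAdvantage
  refine Finset.sum_eq_zero fun pk _ => ?_
  rw [Finset.sum_eq_zero fun H _ => Finset.sum_eq_zero fun s _ => if_neg fun h => ?_, mul_zero,
    mul_zero]
  obtain ⟨i, -⟩ := h.1 0
  exact isEmptyElim i

end Security

theorem mainTheorem6
    (Inst Com Chal Rsp Msg : Type)
    [Fintype Inst] [DecidableEq Inst] [Fintype Com] [DecidableEq Com] [Nonempty Com]
    [Fintype Chal] [DecidableEq Chal] [AddCommGroup Chal] [Nonempty Rsp]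
    [Fintype Msg] [DecidableEq Msg]
    (κ N qH q : ℕ) (hN : N ≤ κ) (hq : q ≤ qH) :
    ∃ R : BlackBoxReduction (κ := κ) N q Inst Com Chal Rsp Msg (AOSSig Com Rsp)
        (HashInput κ Inst Com Msg),
      ∀ (Wit St : Type) (S : SigmaProtocol Inst Wit St Com Chal Rsp)
        (Sim : Inst → Chal → PMF (Com × Rsp))
        (A : NRAAdversary (κ := κ) N q Msg (AOSSig Com Rsp) (HashInput κ Inst Com Msg) Chal),
        ufnraAdvantage (AOS κ Msg S Sim) A ≤
          1 / 2 * (2 * ((qH : ℝ) + (N : ℝ)) + 1) ^ (2 * N) *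
            impAdvantage S (R.toImpAdversary S.instDist A) := by
  rcases Nat.eq_zero_or_pos N with h | h
  -- Without keys there is no index to guess. A ring has at least one member, so no forgery wins and
  -- any reduction will do.
  · refine ⟨measureReduction (PMF.pure ()) (fun v => v.2.2) (fun _ _ => False) (fun _ => q)
      (fun v f _ => forgeryCom v.2.1 f) (fun v f => forgeryRsp v.2.1 f), ?_⟩
    intro Wit St S Sim A
    subst h
    rw [ufnraAdvantage_AOS_eq_zero S Sim A]
    exact mul_nonneg (by positivity) (impAdvantage_nonneg S _)
  · have : NeZero N := ⟨h.ne'⟩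
    refine ⟨aosReduction κ N q Inst Com Chal Rsp Msg, fun Wit St S Sim A => ?_⟩
    exact (ufnraAdvantage_AOS_le S Sim A).trans
      (mul_le_mul_of_nonneg_right (loss_le h.ne' hq) (impAdvantage_nonneg S _))
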